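/- Let $p\ge 1$ be an integer. For $n\ge 1$ let $\mathcal I_p^n=\{\bar{\boldsymbol i}\in[n]^p: i_1<\dots<i_p\}$. For real coefficients $\boldsymbol\alpha=(\alpha[\bar{\boldsymbol i};\bar{\boldsymbol a}])$ let $$H_{n,p}(\boldsymbol\alpha)=\binom np^{-1/2}\sum_{\bar{\boldsymbol i}\in\mathcal I_p^n}\ \sum_{\bar{\boldsymbol a}\in\{1,2,3\}^p}\alpha[\bar{\boldsymbol i};\bar{\boldsymbol a}]\,\sigma_{i_1}^{a_1}\cdots\sigma_{i_p}^{a_p}$$ be the quantum $p$-spin Hamiltonian on $(\mathbb C^2)^{\otimes n}$ (with $H_{n,p}=0$ if $n<p$), where $\sigma_i^a$ is the Pauli matrix $X,Y,Z$ for $a=1,2,3$ acting on qubit $i$ and the identity on the other qubits. Put $$E_{n,p}(\boldsymbol\alpha)=\frac1{\sqrt n}\max_{\phi}\ \langle\phi|H_{n,p}(\boldsymbol\alpha)|\phi\rangle,$$ the maximum being over all unit vectors $\phi\in(\mathbb C^2)^{\otimes n}$. Let $\alpha[\bar{\boldsymbol i};\bar{\boldsymbol a}]$ be i.i.d. standard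 normal. (1) For every $n$ let $\alpha'[\bar{\boldsymbol i};\bar{\boldsymbol a}]$ ($\bar{\boldsymbol i}\in\mathcal I_p^n$, $\bar{\boldsymbol a}\in\{1,2,3\}^p$) be independent real random variables, whose laws may depend on $n$, $\bar{\boldsymbol i}$ and $\bar{\boldsymbol a}$, with mean $0$ and variance $1$, such that for every $\epsilon>0$ $$\lim_{n\to\infty}\frac1{\binom np}\sum_{\bar{\boldsymbol i}\in\mathcal I_p^n}\ \sum_{\bar{\boldsymbol a}\in\{1,2,3\}^p}\mathbb E\Big[\alpha'[\bar{\boldsymbol i};\bar{\boldsymbol a}]^2;\ |\alpha'[\bar{\boldsymbol i};\bar{\boldsymbol a}]|>n^{(p-1)/2}\epsilon\Big]=0 .$$ Then $E_{n,p}(\boldsymbol\alpha)$ and $E_{n,p}(\boldsymbol\alpha')$ are integrable for every $n$, and $$\lim_{n\to\infty}\big(\mathbb E\,E_{n,p}(\boldsymbol\alpha)-\mathbb E\,E_{n,p}(\boldsymbol\alpha')\big)=0 .$$ In particular, $\mathbb E\,E_{n,p}(\boldsymbol\alpha)$ converges to a real number as $n\to\infty$ if and only if $\mathbb E\,E_{n,p}(\boldsymbol\alpha')$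 does, and then $$\lim_{n\to\infty}\mathbb E\,E_{n,p}(\boldsymbol\alpha)=\lim_{n\to\infty}\mathbb E\,E_{n,p}(\boldsymbol\alpha').$$ (2) Let $d_n\to\infty$ (arbitrarily slowly) with $0<d_n\le 3^p\binom n{p-1}$ for all $n\ge p$, and let $\alpha'[\bar{\boldsymbol i};\bar{\boldsymbol a}]$ be i.i.d. for every $n\ge p$, each taking the two values $\pm\sqrt{3^p\binom n{p-1}/d_n}$ with probability $\tfrac12 3^{-p}d_n/\binom n{p-1}$ each, and the value $0$ otherwise. These variables satisfy all the conditions in (1), so that the conclusions of (1) hold for them. -/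

import Mathlib

open Filter Topology MeasureTheory ProbabilityTheory

namespace QuantumSpin

noncomputable section

/-- The Pauli matrices: `pauli 0 = I`, `pauli 1 = X`, `pauli 2 = Y`, `pauli 3 = Z`. -/
def pauli : Fin 4 → Matrix (Fin 2) (Fin 2) ℂ :=
  ![1, !![0, 1; 1, 0], !![0, -Complex.I; Complex.I, 0], !![1, 0; 0, -1]]

/-- Operators on `n` qubits, as matrices in the computational basis; a basis vector of the
`n`-fold tensor power of `ℂ²` is a function `Fin n → Fin 2`. -/
abbrev Operator (n : ℕ) : Type := Matrix (Fin n → Fin 2) (Fin n → Fin 2) ℂ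

/-- The tensor product `σ^{b 0} ⊗ ⋯ ⊗ σ^{b (n-1)}` of Pauli matrices. -/
def pauliTensor {n : ℕ} (b : Fin n → Fin 4) : Operator n :=
  Matrix.of fun s t => ∏ j, pauli (b j) (s j) (t j)

/-- `σ_i^a`: the Pauli matrix `σ^a` on qubit `i`, the identity on all other qubits. -/
def sitePauli {n : ℕ} (i : Fin n) (a : Fin 4) : Operator n :=
  pauliTensor (Function.update (fun _ => 0) i a)

/-- Increasing `p`-tuples `i_1 < ⋯ < i_p` of qubits. -/
abbrev IncTuple (n p : ℕ) : Type := {i : Fin p → Fin n // ∀ j k : Fin p, j < k → i j < i k}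

/-- The labels `(i, a)` of the terms of the Hamiltonian. The entry `a k : Fin 3` stands for the
Pauli index `(a k).succ`, which ranges over `1, 2, 3`. -/
abbrev Term (n p : ℕ) : Type := IncTuple n p × (Fin p → Fin 3)

/-- `P_i^a = σ_{i_1}^{a_1} ⋯ σ_{i_p}^{a_p}`. -/
def pauliString {n p : ℕ} (e : Term n p) : Operator n :=
  (List.ofFn fun k : Fin p => sitePauli (e.1.1 k) (e.2 k).succ).prod

/-- The quantum `p`-spin Hamiltonian `H_{n,p}(α)` with coefficients `α[i; a]`. -/
def hamiltonian (n p : ℕ) (α : Term n p → ℝ) : Operator n :=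
  ((1 / Real.sqrt (n.choose p) : ℝ) : ℂ) •
    ∑ i : IncTuple n p, ∑ a : Fin p → Fin 3, (α (i, a) : ℂ) • pauliString (i, a)

/-- The pure states of `n` qubits: unit vectors. -/
def allStates (n : ℕ) : Set (EuclideanSpace ℂ (Fin n → Fin 2)) := Metric.sphere 0 1

/-- The energy `⟨φ|M|φ⟩` (a real number when `M` is Hermitian). -/
def energy {n : ℕ} (M : Operator n) (φ : EuclideanSpace ℂ (Fin n → Fin 2)) : ℝ :=
  (inner ℂ φ (Matrix.toEuclideanLin M φ)).re

/-- The maximum of `⟨φ|M|φ⟩` over all states; it is attained, see `isGreatest_maxEnergy`. -/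
def maxEnergy {n : ℕ} (M : Operator n) : ℝ := sSup (energy M '' allStates n)

theorem isGreatest_maxEnergy {n : ℕ} (M : Operator n) :
    IsGreatest (energy M '' allStates n) (maxEnergy M) := by
  have hc : IsCompact (energy M '' allStates n) := by
    refine (isCompact_sphere _ _).image ?_
    have h : Continuous (Matrix.toEuclideanLin M) := LinearMap.continuous_of_finiteDimensional _
    unfold energy
    fun_prop
  have hne : (energy M '' allStates n).Nonempty :=
    (NormedSpace.sphere_nonempty.2 zero_le_one).image _
  exact hc.isGreatest_sSup hne

/-- The random variable `n^{-1/2} max_φ ⟨φ|H_{n,p}(α)|φ⟩`, as a function of the coefficients. -/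
def normalizedMaxEnergy (n p : ℕ) (α : Term n p → ℝ) : ℝ :=
  1 / Real.sqrt n * maxEnergy (hamiltonian n p α)

/-- The joint law of independent coefficients `α[i; a] ∼ μ (i, a)`. -/
def disorder {n p : ℕ} (μ : Term n p → Measure ℝ) : Measure (Term n p → ℝ) := Measure.pi μ

/-- The joint law of i.i.d. standard normal coefficients. -/
def gaussianDisorder (n p : ℕ) : Measure (Term n p → ℝ) := disorder fun _ => gaussianReal 0 1

/-- The moment and tail conditions on the laws `D n (i, a)` of the coefficients. -/
structure DisorderConditions (p : ℕ) (D : ∀ n : ℕ, Term n p → Measure ℝ) : Prop where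
  isProbability : ∀ n e, IsProbabilityMeasure (D n e)
  first_moment : ∀ n e, ∫ x, x ∂(D n e) = 0
  second_moment : ∀ n e, ∫ x, x ^ 2 ∂(D n e) = 1
  boundedness : ∀ ε : ℝ, 0 < ε →
    Tendsto (fun n : ℕ => 1 / (n.choose p : ℝ) *
      ∑ i : IncTuple n p, ∑ a : Fin p → Fin 3,
        ∫ x in {x : ℝ | (n : ℝ) ^ (((p : ℝ) - 1) / 2) * ε < |x|}, x ^ 2 ∂(D n (i, a)))
      atTop (𝓝 0)

/-- The energies under Gaussian disorder and under the disorder `D` are integrable, and their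
expectations are asymptotically equal: the difference tends to `0`, so that one of the two
sequences converges if and only if the other one does, with the same limit. -/
structure SameLimitingEnergy (p : ℕ) (D : ∀ n : ℕ, Term n p → Measure ℝ) : Prop where
  integrable_gaussian : ∀ n, Integrable (normalizedMaxEnergy n p) (gaussianDisorder n p)
  integrable : ∀ n, Integrable (normalizedMaxEnergy n p) (disorder (D n))
  tendsto_sub : Tendsto (fun n : ℕ =>
      (∫ α, normalizedMaxEnergy n p α ∂(gaussianDisorder n p)) -
        ∫ α, normalizedMaxEnergy n p α ∂(disorder (D n))) atTop (𝓝 0)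
  tendsto_iff : ∀ L : ℝ,
    Tendsto (fun n : ℕ => ∫ α, normalizedMaxEnergy n p α ∂(gaussianDisorder n p)) atTop (𝓝 L) ↔
      Tendsto (fun n : ℕ => ∫ α, normalizedMaxEnergy n p α ∂(disorder (D n))) atTop (𝓝 L)

/-- The probability `3^{-p} d / C(n, p-1)` that a coefficient of the sparse model is nonzero. -/
def sparseProb (n p : ℕ) (d : ℝ) : ℝ := d / (3 ^ p * (n.choose (p - 1) : ℝ))

/-- The law of a coefficient of the sparse model of average degree `d`, with `q` the probability
above: the values `± √(3^p C(n, p-1) / d)` have probability `q / 2` each, and `0` has the rest. -/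
def sparseLaw (n p : ℕ) (d : ℝ) : Measure ℝ :=
  ENNReal.ofReal (1 - sparseProb n p d) • Measure.dirac 0 +
  ENNReal.ofReal (sparseProb n p d / 2) •
    Measure.dirac (Real.sqrt (3 ^ p * (n.choose (p - 1) : ℝ) / d)) +
  ENNReal.ofReal (sparseProb n p d / 2) •
    Measure.dirac (-Real.sqrt (3 ^ p * (n.choose (p - 1) : ℝ) / d))

end

end QuantumSpin

/-! The maximal energy is not smooth in the coefficients, so it is replaced by the free energy
`(βn)⁻¹ log tr exp(β√n H)`. As the space has dimension `2^n`, this costs at most `log 2 / β`,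
whatever the disorder.

The free energies under two disorders are compared by Lindeberg's method, exchanging one coefficient
at a time. In one coefficient the Hamiltonian is affine, with a Pauli string `P` as slope, so what
is needed is a second order expansion of `x ↦ log tr exp(A + xP)`, uniform in `A`. The first two
moments of the laws agree, so the quadratic polynomial contributes equally to both expectations and
only the remainder `min(x², |x|³)` counts.

That remainder comes from complex analysis. The function `F(z) = tr exp(A + zP)` is entire, and
Bernstein's inequality `|tr exp X| ≤ tr exp((X + Xᴴ)/2)` together with `|⟨φ|P|φ⟩| ≤ 1` gives `|F(z)|
≤ exp|Re z - x| F(x)` for real `x`. Cauchy's estimates on unit circles then bound every `F^(k)/F` on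
the real line by an absolute constant, hence also the second and third derivatives of `log F`. No
non-commutative derivative of the exponential has to be computed.

Each coefficient enters with scale `t = β√n / √C(n,p)`. There are `3^p C(n,p)` of them, so the
quadratic remainders sum to order `β` times the averaged tail second moments, and the cubic ones
below the threshold `n^((p-1)/2) ε` to order `β² ε`. Taking `β` large, then `ε` small, then `n`
large proves the comparison. For `p = 1` the tail condition is contradictory; for `p ≥ 2` the
Gaussian law satisfies it, and one comparison suffices. -/

namespace QuantumSpin

/-! ### Trace inequalities for powers of matrices -/

section TraceInequalities

open Matrix

variable {m : Type*} [Fintype m]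

theorem re_trace_mul_conjTranspose (X : Matrix m m ℂ) :
    (X * Xᴴ).trace.re = ∑ i, ∑ j, ‖X i j‖ ^ 2 := by
  simp only [Matrix.trace, Matrix.diag, Matrix.mul_apply, Matrix.conjTranspose_apply,
    Complex.re_sum]
  refine Finset.sum_congr rfl fun i _ => Finset.sum_congr rfl fun j _ => ?_
  rw [← Complex.normSq_eq_norm_sq, Complex.star_def, Complex.mul_conj, Complex.ofReal_re]

/-- Entrywise AM-GM. This additive form of Cauchy-Schwarz loses nothing below, where the two traces
on the right coincide. -/
theorem norm_trace_mul_le (X Y : Matrix m m ℂ) :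
    ‖(X * Y).trace‖ ≤ ((X * Xᴴ).trace.re + (Y * Yᴴ).trace.re) / 2 := by
  rw [re_trace_mul_conjTranspose, re_trace_mul_conjTranspose Y,
    Finset.sum_comm (f := fun i j => ‖Y i j‖ ^ 2),
    ← Finset.sum_add_distrib, Finset.sum_div]
  simp only [Matrix.trace, Matrix.diag, Matrix.mul_apply]
  refine (norm_sum_le _ _).trans (Finset.sum_le_sum fun i _ => (norm_sum_le _ _).trans ?_)
  rw [← Finset.sum_add_distrib, Finset.sum_div]
  refine Finset.sum_le_sum fun j _ => ?_
  rw [norm_mul]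
  nlinarith [sq_nonneg (‖X i j‖ - ‖Y j i‖)]

variable [DecidableEq m]

theorem trace_mul_pow_comm (A B : Matrix m m ℂ) (n : ℕ) :
    ((A * B) ^ n).trace = ((B * A) ^ n).trace := by
  cases n with
  | zero => simp
  | succ n =>
    have h : A * (B * A) ^ n = (A * B) ^ n * A := by
      induction n with
      | zero => simp
      | succ n ih => rw [pow_succ, ← mul_assoc, ih, pow_succ]; simp only [mul_assoc]
    rw [pow_succ, ← mul_assoc, ← h, Matrix.trace_mul_comm, ← mul_assoc, ← pow_succ']

/-- The trace inequalities behind the Golden-Thompson inequality, by simultaneous induction. -/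
theorem trace_pow_two_pow_le (k : ℕ) :
    (∀ X : Matrix m m ℂ, ‖(X ^ 2 ^ (k + 1)).trace‖ ≤ ((X * Xᴴ) ^ 2 ^ k).trace.re) ∧
      ∀ A B : Matrix m m ℂ, A.IsHermitian → B.IsHermitian →
        ‖((A * B) ^ 2 ^ k).trace‖ ≤ ‖(A ^ 2 ^ k * B ^ 2 ^ k).trace‖ := by
  induction k with
  | zero =>
    refine ⟨fun X => ?_, fun A B _ _ => by simp⟩
    have := norm_trace_mul_le X X
    rw [show X ^ 2 ^ (0 + 1) = X * X by simp [sq]]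
    simpa using this
  | succ k ih =>
    obtain ⟨hW, hG⟩ := ih
    constructor
    -- Apply the first bound to `X²`, cycle the trace so that the Hermitian factors `XXᴴ` and `XᴴX`
    -- appear, and split them by the second bound; powers of these two factors have equal traces.
    · intro X
      have hA : (Xᴴ * X).IsHermitian := isHermitian_conjTranspose_mul_self X
      have hB : (X * Xᴴ).IsHermitian := isHermitian_mul_conjTranspose_self X
      calc ‖(X ^ 2 ^ (k + 1 + 1)).trace‖ = ‖((X ^ 2) ^ 2 ^ (k + 1)).trace‖ := by
            rw [← pow_mul, pow_succ' 2 (k + 1)]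
        _ ≤ ((X ^ 2 * (X ^ 2)ᴴ) ^ 2 ^ k).trace.re := hW _
        _ = (((X * Xᴴ) * (Xᴴ * X)) ^ 2 ^ k).trace.re := by
            rw [show X ^ 2 * (X ^ 2)ᴴ = X * (X * Xᴴ * Xᴴ) by
              simp only [sq, conjTranspose_mul, mul_assoc], trace_mul_pow_comm]
            simp only [mul_assoc]
        _ ≤ ‖(((X * Xᴴ) * (Xᴴ * X)) ^ 2 ^ k).trace‖ := Complex.re_le_norm _
        _ ≤ _ := hG _ _ hB hA
        _ ≤ _ := norm_trace_mul_le _ _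
        _ = _ := by
            rw [(hB.pow _).eq, (hA.pow _).eq, ← pow_add, ← pow_add, trace_mul_pow_comm Xᴴ X,
              show 2 ^ k + 2 ^ k = 2 ^ (k + 1) by ring]
            ring
    -- The first bound at `AB`, then cyclicity, turns `AB` into `A²B²` with half the exponent.
    · intro A B hA hB
      calc ‖((A * B) ^ 2 ^ (k + 1)).trace‖ ≤ ((A * B * (A * B)ᴴ) ^ 2 ^ k).trace.re := hW _
        _ = ((A ^ 2 * B ^ 2) ^ 2 ^ k).trace.re := by
            rw [conjTranspose_mul, hA.eq, hB.eq, show A * B * (B * A) = A * (B * B * A) by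
              simp only [mul_assoc], trace_mul_pow_comm, trace_mul_pow_comm (A ^ 2)]
            simp only [sq, mul_assoc]
        _ ≤ _ := Complex.re_le_norm _
        _ ≤ _ := hG _ _ (hA.pow 2) (hB.pow 2)
        _ = _ := by rw [← pow_mul, ← pow_mul, ← pow_succ']

end TraceInequalities

/-! ### The Lie product formula -/

section Trotter

variable {𝔸 : Type*} [NormedRing 𝔸] [NormOneClass 𝔸]

theorem norm_pow_sub_pow_le {U V : 𝔸} {M : ℝ} (hM : 1 ≤ M) (hU : ‖U‖ ≤ M) (hV : ‖V‖ ≤ M)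
    (n : ℕ) : ‖U ^ n - V ^ n‖ ≤ n * M ^ n * ‖U - V‖ := by
  induction n with
  | zero => simp
  | succ n ih =>
    have e : U ^ (n + 1) - V ^ (n + 1) = (U ^ n - V ^ n) * U + V ^ n * (U - V) := by
      rw [pow_succ, pow_succ]; noncomm_ring
    have h0 : 0 ≤ M := zero_le_one.trans hM
    have h1 : ‖V ^ n‖ ≤ M ^ (n + 1) :=
      (norm_pow_le V n).trans ((pow_le_pow_left₀ (norm_nonneg _) hV n).trans
        (pow_le_pow_right₀ hM n.le_succ))
    calc ‖U ^ (n + 1) - V ^ (n + 1)‖ ≤ ‖U ^ n - V ^ n‖ * ‖U‖ + ‖V ^ n‖ * ‖U - V‖ := by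
          rw [e]; exact (norm_add_le _ _).trans (add_le_add (norm_mul_le _ _) (norm_mul_le _ _))
      _ ≤ n * M ^ n * ‖U - V‖ * M + M ^ (n + 1) * ‖U - V‖ := by gcongr
      _ = _ := by push_cast; ring

variable [NormedAlgebra ℝ 𝔸]

theorem norm_exp_le_exp_norm (x : 𝔸) :
    ‖NormedSpace.exp x‖ ≤ Real.exp ‖x‖ := by
  rw [NormedSpace.exp_eq_tsum ℝ, Real.exp_eq_exp_ℝ, NormedSpace.exp_eq_tsum ℝ]
  refine tsum_of_norm_bounded (NormedSpace.expSeries_summable' (𝕂 := ℝ) ‖x‖).hasSum fun n => ?_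
  rw [norm_smul, smul_eq_mul]
  gcongr
  · rw [Real.norm_of_nonneg (by positivity)]
  · exact norm_pow_le x n

/-- The Lie product formula. -/
theorem tendsto_exp_mul_exp_pow [CompleteSpace 𝔸] (A B : 𝔸) :
    Tendsto (fun n : ℕ => (NormedSpace.exp ((n : ℝ)⁻¹ • A) * NormedSpace.exp ((n : ℝ)⁻¹ • B)) ^ n)
      atTop (𝓝 (NormedSpace.exp (A + B))) := by
  -- The two curves agree to first order at `0`, so at `t = 1/n` their difference is `o(1/n)`;
  -- telescoping the `n`-th powers costs only a factor of order `n`.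
  have hd : HasDerivAt (fun t : ℝ => NormedSpace.exp (t • A) * NormedSpace.exp (t • B) -
      NormedSpace.exp (t • (A + B))) 0 (0 : ℝ) := by
    refine (((hasDerivAt_exp_smul_const A (0 : ℝ)).mul (hasDerivAt_exp_smul_const B (0 : ℝ))).sub
      (hasDerivAt_exp_smul_const (A + B) (0 : ℝ))).congr_deriv ?_
    simp
  have hs := hd.tendsto_slope
  have hn : Tendsto (fun n : ℕ => ((n : ℝ)⁻¹)) atTop (𝓝[≠] 0) :=
    tendsto_nhdsWithin_iff.2 ⟨tendsto_inv_atTop_nhds_zero_nat,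
      (eventually_gt_atTop 0).mono fun n hn => by simpa using hn.ne'⟩
  have hl := (hs.comp hn).norm.const_mul (Real.exp (‖A‖ + ‖B‖))
  rw [norm_zero, mul_zero] at hl
  rw [tendsto_iff_norm_sub_tendsto_zero]
  refine squeeze_zero' (Eventually.of_forall fun _ => norm_nonneg _) ?_ hl
  filter_upwards [eventually_gt_atTop 0] with n hn
  have hn' : (0 : ℝ) < n := by exact_mod_cast hn
  have e1 : NormedSpace.exp (A + B) = NormedSpace.exp ((n : ℝ)⁻¹ • (A + B)) ^ n := by
    let : NormedAlgebra ℚ 𝔸 := .restrictScalars ℚ ℝ 𝔸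
    rw [← NormedSpace.exp_nsmul, ← Nat.cast_smul_eq_nsmul ℝ, smul_smul, mul_inv_cancel₀ hn'.ne',
      one_smul]
  set M := Real.exp ((n : ℝ)⁻¹ * (‖A‖ + ‖B‖)) with hM
  have hs' : ∀ C : 𝔸, ‖(n : ℝ)⁻¹ • C‖ = (n : ℝ)⁻¹ * ‖C‖ := fun C => by
    rw [norm_smul, Real.norm_of_nonneg (by positivity)]
  have h1 : 1 ≤ M := Real.one_le_exp (by positivity)
  have hU : ‖NormedSpace.exp ((n : ℝ)⁻¹ • A) * NormedSpace.exp ((n : ℝ)⁻¹ • B)‖ ≤ M := by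
    refine (norm_mul_le _ _).trans ?_
    rw [hM, mul_add, Real.exp_add, ← hs', ← hs']
    gcongr <;> exact norm_exp_le_exp_norm _
  have hV : ‖NormedSpace.exp ((n : ℝ)⁻¹ • (A + B))‖ ≤ M := by
    refine (norm_exp_le_exp_norm _).trans (Real.exp_le_exp.2 ?_)
    rw [hs']
    gcongr
    exact norm_add_le _ _
  rw [e1]
  refine (norm_pow_sub_pow_le h1 hU hV n).trans (le_of_eq ?_)
  have hMn : M ^ n = Real.exp (‖A‖ + ‖B‖) := by
    rw [hM, ← Real.exp_nat_mul, ← mul_assoc, mul_inv_cancel₀ hn'.ne', one_mul]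
  rw [hMn]
  simp [slope_def_module, norm_smul]
  ring

end Trotter

/-! ### Bernstein's trace inequality -/

section Bernstein

open Matrix
open scoped Matrix.Norms.Operator

variable {m : Type*} [Fintype m] [DecidableEq m] [Nonempty m]

/-- Bernstein's trace inequality. -/
theorem norm_trace_exp_le (X : Matrix m m ℂ) :
    ‖(NormedSpace.exp X).trace‖ ≤
      (NormedSpace.exp ((1 / 2 : ℝ) • X + (1 / 2 : ℝ) • Xᴴ)).trace.re := by
  have h := (tendsto_exp_mul_exp_pow ((1 / 2 : ℝ) • X) ((1 / 2 : ℝ) • Xᴴ)).comp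
    (tendsto_pow_atTop_atTop_of_one_lt (one_lt_two : (1 : ℕ) < 2))
  have hc : Continuous fun M : Matrix m m ℂ => M.trace.re :=
    Complex.continuous_re.comp (continuous_id.matrix_trace)
  refine ge_of_tendsto ((hc.tendsto _).comp h) (Eventually.of_forall fun k => ?_)
  -- The power bound is applied to `Y = exp(X / 2^(k+1))`: then `(YYᴴ)^(2^k)` is the Lie product
  -- along the subsequence `2^k`.
  have e : NormedSpace.exp X =
      NormedSpace.exp (((2 ^ k : ℕ) : ℝ)⁻¹ • (1 / 2 : ℝ) • X) ^ 2 ^ (k + 1) := by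
    rw [← Matrix.exp_nsmul, ← Nat.cast_smul_eq_nsmul ℝ, smul_smul, smul_smul]
    congr 1
    have : ((2 ^ (k + 1) : ℕ) : ℝ) * ((2 ^ k : ℕ) : ℝ)⁻¹ * (1 / 2) = 1 := by
      push_cast
      field_simp
      ring
    rw [this, one_smul]
  rw [e]
  refine ((trace_pow_two_pow_le k).1 _).trans (le_of_eq ?_)
  simp [← Matrix.exp_conjTranspose, conjTranspose_smul]
  rfl

end Bernstein

/-! ### Spectral bounds for the partition function -/

section PartitionFunction

variable {n : ℕ}

theorem energy_add (A B : Operator n) (φ : EuclideanSpace ℂ (Fin n → Fin 2)) :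
    energy (A + B) φ = energy A φ + energy B φ := by
  simp [energy, map_add]

theorem energy_smul (r : ℝ) (A : Operator n) (φ : EuclideanSpace ℂ (Fin n → Fin 2)) :
    energy ((r : ℂ) • A) φ = r * energy A φ := by
  rw [energy, map_smul, LinearMap.smul_apply, inner_smul_right, Complex.re_ofReal_mul, energy]

theorem energy_sum {ι : Type*} (s : Finset ι) (A : ι → Operator n)
    (φ : EuclideanSpace ℂ (Fin n → Fin 2)) :
    energy (∑ i ∈ s, A i) φ = ∑ i ∈ s, energy (A i) φ := by
  simp [energy, map_sum]

theorem energy_le_maxEnergy (A : Operator n) {φ : EuclideanSpace ℂ (Fin n → Fin 2)}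
    (hφ : ‖φ‖ = 1) : energy A φ ≤ maxEnergy A :=
  (isGreatest_maxEnergy A).2 ⟨φ, by simpa [allStates] using hφ, rfl⟩

theorem exists_energy_eq_maxEnergy (A : Operator n) :
    ∃ φ : EuclideanSpace ℂ (Fin n → Fin 2), ‖φ‖ = 1 ∧ energy A φ = maxEnergy A := by
  obtain ⟨φ, hφ, h⟩ := (isGreatest_maxEnergy A).1
  exact ⟨φ, by simpa [allStates] using hφ, h⟩

/-- The partition function `tr exp(A)`. -/
noncomputable def partitionFunction (A : Operator n) : ℝ := (NormedSpace.exp A).trace.re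

variable {A B : Operator n}

theorem partitionFunction_eq_sum (hA : A.IsHermitian) :
    partitionFunction A = ∑ j, Real.exp (hA.eigenvalues j) := by
  have h1 : (hA.eigenvectorUnitary : Operator n)⁻¹ = star (hA.eigenvectorUnitary : Operator n) :=
    Matrix.inv_eq_left_inv (Unitary.coe_star_mul_self _)
  have h2 : IsUnit (hA.eigenvectorUnitary : Operator n) :=
    ⟨Unitary.toUnits hA.eigenvectorUnitary, rfl⟩
  have h3 : NormedSpace.exp A = hA.eigenvectorUnitary *
      Matrix.diagonal (NormedSpace.exp (RCLike.ofReal ∘ hA.eigenvalues : (Fin n → Fin 2) → ℂ)) *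
        star (hA.eigenvectorUnitary : Operator n) := by
    conv_lhs => rw [hA.spectral_theorem, Unitary.conjStarAlgAut_apply]
    rw [← h1, Matrix.exp_conj _ _ h2, Matrix.exp_diagonal]
  rw [partitionFunction, h3, Matrix.trace_mul_comm, ← mul_assoc, Unitary.coe_star_mul_self, one_mul,
    Matrix.trace_diagonal, Complex.re_sum]
  refine Finset.sum_congr rfl fun j _ => ?_
  rw [Pi.coe_exp, ← Complex.exp_eq_exp_ℂ]
  exact Complex.exp_ofReal_re _

theorem energy_eq_sum (hA : A.IsHermitian) (φ : EuclideanSpace ℂ (Fin n → Fin 2)) :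
    energy A φ = ∑ j, ‖inner ℂ (hA.eigenvectorBasis j) φ‖ ^ 2 * hA.eigenvalues j := by
  have hs : (Matrix.toEuclideanLin A).IsSymmetric := Matrix.isSymmetric_toEuclideanLin_iff.2 hA
  rw [energy, ← hA.eigenvectorBasis.sum_inner_mul_inner, Complex.re_sum]
  refine Finset.sum_congr rfl fun j _ => ?_
  have he : Matrix.toEuclideanLin A (hA.eigenvectorBasis j) =
      (hA.eigenvalues j : ℂ) • hA.eigenvectorBasis j := by
    ext i
    have := congrFun (hA.mulVec_eigenvectorBasis j) i
    simpa [Matrix.toLpLin_apply] using this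
  rw [← hs, he, inner_smul_left, Complex.conj_ofReal, mul_left_comm, ← inner_conj_symm φ,
    ← Complex.normSq_eq_conj_mul_self, Complex.normSq_eq_norm_sq, ← Complex.ofReal_mul,
    Complex.ofReal_re, mul_comm]

/-- Jensen's inequality for the spectral distribution of `A` in the state `φ`. -/
theorem exp_energy_le_sum (hA : A.IsHermitian) {φ : EuclideanSpace ℂ (Fin n → Fin 2)}
    (hφ : ‖φ‖ = 1) : Real.exp (energy A φ) ≤
      ∑ j, ‖inner ℂ (hA.eigenvectorBasis j) φ‖ ^ 2 * Real.exp (hA.eigenvalues j) := by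
  rw [energy_eq_sum hA]
  refine convexOn_exp.map_sum_le (fun _ _ => by positivity) ?_ (fun _ _ => Set.mem_univ _)
  rw [hA.eigenvectorBasis.sum_sq_norm_inner_right, hφ, one_pow]

/-- The Peierls inequality. -/
theorem sum_exp_energy_le (hA : A.IsHermitian)
    (b : OrthonormalBasis (Fin n → Fin 2) ℂ (EuclideanSpace ℂ (Fin n → Fin 2))) :
    ∑ i, Real.exp (energy A (b i)) ≤ partitionFunction A := by
  refine (Finset.sum_le_sum fun i _ => exp_energy_le_sum hA (b.norm_eq_one i)).trans (le_of_eq ?_)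
  rw [Finset.sum_comm, partitionFunction_eq_sum hA]
  refine Finset.sum_congr rfl fun j _ => ?_
  rw [← Finset.sum_mul, b.sum_sq_norm_inner_left, OrthonormalBasis.norm_eq_one, one_pow, one_mul]

theorem energy_eigenvectorBasis (hA : A.IsHermitian) (j : Fin n → Fin 2) :
    energy A (hA.eigenvectorBasis j) = hA.eigenvalues j := by
  rw [energy_eq_sum hA, Finset.sum_eq_single j]
  · simp
  · intro i _ hij
    simp [OrthonormalBasis.inner_eq_zero _ hij]
  · simp

/-- `A` and `B` need not commute: the Peierls inequality for `B` is used in the eigenbasis of `A`.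
-/
theorem partitionFunction_le (hA : A.IsHermitian) (hB : B.IsHermitian) {c : ℝ}
    (h : ∀ φ : EuclideanSpace ℂ (Fin n → Fin 2), ‖φ‖ = 1 → energy A φ ≤ energy B φ + c) :
    partitionFunction A ≤ Real.exp c * partitionFunction B := by
  rw [partitionFunction_eq_sum hA]
  calc ∑ j, Real.exp (hA.eigenvalues j)
      ≤ ∑ j, Real.exp c * Real.exp (energy B (hA.eigenvectorBasis j)) := by
        refine Finset.sum_le_sum fun j _ => ?_
        rw [← energy_eigenvectorBasis hA, ← Real.exp_add, add_comm c]
        exact Real.exp_le_exp.2 (h _ (hA.eigenvectorBasis.norm_eq_one j))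
    _ ≤ _ := by
        rw [← Finset.mul_sum]
        exact mul_le_mul_of_nonneg_left (sum_exp_energy_le hB _) (Real.exp_pos _).le

theorem exp_maxEnergy_le_partitionFunction (hA : A.IsHermitian) :
    Real.exp (maxEnergy A) ≤ partitionFunction A := by
  obtain ⟨φ, hφ, h⟩ := exists_energy_eq_maxEnergy A
  rw [← h, partitionFunction_eq_sum hA]
  refine (exp_energy_le_sum hA hφ).trans (Finset.sum_le_sum fun j _ => ?_)
  refine mul_le_of_le_one_left (Real.exp_pos _).le (pow_le_one₀ (norm_nonneg _) ?_)
  simpa [hφ] using norm_inner_le_norm (𝕜 := ℂ) (hA.eigenvectorBasis j) φ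

theorem partitionFunction_le_exp_maxEnergy (hA : A.IsHermitian) :
    partitionFunction A ≤ 2 ^ n * Real.exp (maxEnergy A) := by
  rw [partitionFunction_eq_sum hA]
  refine (Finset.sum_le_sum fun j _ => Real.exp_le_exp.2 (?_ : _ ≤ maxEnergy A)).trans ?_
  · rw [← energy_eigenvectorBasis hA]
    exact energy_le_maxEnergy A (hA.eigenvectorBasis.norm_eq_one j)
  · simp

theorem partitionFunction_pos (hA : A.IsHermitian) : 0 < partitionFunction A :=
  (Real.exp_pos _).trans_le (exp_maxEnergy_le_partitionFunction hA)

theorem abs_log_partitionFunction_sub_maxEnergy_le (hA : A.IsHermitian) :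
    |Real.log (partitionFunction A) - maxEnergy A| ≤ n * Real.log 2 := by
  have h1 := Real.log_le_log (Real.exp_pos _) (exp_maxEnergy_le_partitionFunction hA)
  have h2 := Real.log_le_log (partitionFunction_pos hA) (partitionFunction_le_exp_maxEnergy hA)
  rw [Real.log_exp] at h1
  rw [Real.log_mul (by positivity) (Real.exp_pos _).ne', Real.log_exp, Real.log_pow] at h2
  have := mul_nonneg n.cast_nonneg (Real.log_nonneg (one_le_two (α := ℝ)))
  exact abs_le.2 ⟨by linarith, by linarith⟩

end PartitionFunction

/-! ### Taylor expansion of the logarithm of an entire function -/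

section Taylor

theorem abs_le_mul_abs_pow_of_hasDerivAt {h h' : ℝ → ℝ} {C : ℝ} {k : ℕ} (h0 : h 0 = 0)
    (hd : ∀ y, HasDerivAt h (h' y) y) (hC : 0 ≤ C) (hb : ∀ y, |h' y| ≤ C * |y| ^ k) (x : ℝ) :
    |h x| ≤ C * |x| ^ (k + 1) := by
  have := (convex_uIcc (0 : ℝ) x).norm_image_sub_le_of_norm_hasDerivWithin_le
    (f := h) (f' := h') (C := C * |x| ^ k) (fun y _ => (hd y).hasDerivWithinAt) (fun y hy => ?_)
    Set.left_mem_uIcc Set.right_mem_uIcc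
  · simpa [h0, pow_succ, mul_assoc] using this
  · refine (hb y).trans ?_
    have : |y| ≤ |x| := by simpa using Set.abs_sub_left_of_mem_uIcc hy
    gcongr

/-- The increment of `g₂` from `0` is at most `2C` and at most `2C|y|`; integrating twice gives the
square and the cube. The square is needed because the laws may have only two moments. -/
theorem abs_taylor_two_le {g g₁ g₂ g₃ : ℝ → ℝ} {C : ℝ} (h₁ : ∀ y, HasDerivAt g (g₁ y) y)
    (h₂ : ∀ y, HasDerivAt g₁ (g₂ y) y) (h₃ : ∀ y, HasDerivAt g₂ (g₃ y) y)
    (hC₂ : ∀ y, |g₂ y| ≤ C) (hC₃ : ∀ y, |g₃ y| ≤ 2 * C) (x : ℝ) :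
    |g x - g 0 - g₁ 0 * x - g₂ 0 / 2 * x ^ 2| ≤ 2 * C * min (x ^ 2) (|x| ^ 3) := by
  have hC : 0 ≤ 2 * C := (abs_nonneg _).trans (hC₃ 0)
  have d₁ : ∀ y, HasDerivAt (fun x => g x - g 0 - g₁ 0 * x - g₂ 0 / 2 * x ^ 2)
      (g₁ y - g₁ 0 - g₂ 0 * y) y := fun y => by
    convert! (((h₁ y).sub_const (g 0)).sub ((hasDerivAt_id y).const_mul (g₁ 0))).sub
      ((hasDerivAt_pow 2 y).const_mul (g₂ 0 / 2)) using 1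
    push_cast
    ring
  have d₂ : ∀ y, HasDerivAt (fun y => g₁ y - g₁ 0 - g₂ 0 * y) (g₂ y - g₂ 0) y := fun y => by
    convert! ((h₂ y).sub_const (g₁ 0)).sub ((hasDerivAt_id y).const_mul (g₂ 0)) using 1
    ring
  have d₃ : ∀ y, HasDerivAt (fun y => g₂ y - g₂ 0) (g₃ y) y := fun y => (h₃ y).sub_const _
  have b₂ : ∀ y, |g₂ y - g₂ 0| ≤ 2 * C * |y| ^ 0 := fun y => by
    linarith [hC₂ y, hC₂ 0, abs_sub (g₂ y) (g₂ 0)]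
  have b₃ := abs_le_mul_abs_pow_of_hasDerivAt (k := 0) (by simp) d₃ hC (by simpa using hC₃)
  have e₁ := abs_le_mul_abs_pow_of_hasDerivAt (by simp) d₁ hC
    (abs_le_mul_abs_pow_of_hasDerivAt (by simp) d₂ hC b₂) x
  have e₂ := abs_le_mul_abs_pow_of_hasDerivAt (by simp) d₁ hC
    (abs_le_mul_abs_pow_of_hasDerivAt (by simp) d₂ hC b₃) x
  rw [mul_min_of_nonneg _ _ hC]
  exact le_min (by simpa using e₁) (by simpa using e₂)

/-- A positive function on the line whose entire extension is controlled by its values has a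
logarithm with bounded second and third derivatives. -/
theorem exists_abs_log_taylor_le {F : ℂ → ℂ} (hF : Differentiable ℂ F)
    (hpos : ∀ x : ℝ, 0 < (F x).re)
    (hb : ∀ (z : ℂ) (x : ℝ), ‖F z‖ ≤ Real.exp |z.re - x| * (F x).re) :
    ∃ a b : ℝ, ∀ x : ℝ, |Real.log (F x).re - Real.log (F 0).re - a * x - b * x ^ 2| ≤
      126 * min (x ^ 2) (|x| ^ 3) := by
  have hdiff : ∀ k, Differentiable ℂ (iteratedDeriv k F) := fun k =>
    (hF.contDiff (n := ⊤)).differentiable_iteratedDeriv k (by exact_mod_cast WithTop.coe_lt_top _)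
  have hR : ∀ k (x : ℝ), HasDerivAt (fun x : ℝ => (iteratedDeriv k F x).re)
      (iteratedDeriv (k + 1) F x).re x := fun k x => by
    rw [iteratedDeriv_succ]
    exact ((hdiff k x).hasDerivAt).real_of_complex
  -- Cauchy's estimate on the unit circle about `x`, where `|Re z - x| ≤ 1`, with `e < 3`.
  have hC : ∀ k (x : ℝ), |(iteratedDeriv k F x).re / (F x).re| ≤ k.factorial * 3 := fun k x => by
    rw [abs_div, abs_of_pos (hpos x), div_le_iff₀ (hpos x)]
    refine (Complex.abs_re_le_norm _).trans ?_
    have := Complex.norm_iteratedDeriv_le_of_forall_mem_sphere_norm_le k (c := x) (R := 1)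
      (C := Real.exp 1 * (F x).re) one_pos hF.diffContOnCl (fun z hz => ?_)
    · refine this.trans ?_
      rw [one_pow, div_one, mul_assoc]
      have := (hpos x).le
      have := Real.exp_one_lt_three.le
      gcongr
    · refine (hb z x).trans ?_
      have := (hpos x).le
      gcongr
      have h1 : ‖z - x‖ = 1 := by simpa using hz
      have h2 := Complex.abs_re_le_norm (z - x)
      simpa [h1] using h2
  set Z : ℕ → ℝ → ℝ := fun k x => (iteratedDeriv k F x).re with hZ
  have hZ0 : ∀ x, Z 0 x = (F x).re := fun x => by simp [hZ]
  have hne : ∀ x, Z 0 x ≠ 0 := fun x => by rw [hZ0]; exact (hpos x).ne'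
  set r : ℕ → ℝ → ℝ := fun k x => Z k x / Z 0 x with hr
  have hrb : ∀ k x, |r k x| ≤ k.factorial * 3 := fun k x => by
    simp only [hr, hZ0]
    exact hC k x
  have hrd : ∀ k x, HasDerivAt (r k) (r (k + 1) x - r k x * r 1 x) x := fun k x => by
    refine ((hR k x).div (hR 0 x) (hne x)).congr_deriv ?_
    have := hne x
    simp only [hr, hZ] at this ⊢
    field_simp
  have hl : ∀ x, HasDerivAt (fun x => Real.log (Z 0 x)) (r 1 x) x := fun x =>
    (hR 0 x).log (hne x)
  have h1 := hrd 1
  have h2 : ∀ x, HasDerivAt (fun x => r (1 + 1) x - r 1 x * r 1 x)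
      (r 3 x - 3 * r 1 x * r 2 x + 2 * r 1 x ^ 3) x := fun x => by
    refine ((hrd 2 x).sub ((hrd 1 x).mul (hrd 1 x))).congr_deriv ?_
    ring
  refine ⟨r 1 0, (r (1 + 1) 0 - r 1 0 * r 1 0) / 2, fun x => ?_⟩
  have b1 : ∀ x, |r 1 x| ≤ 3 := fun x => by simpa using hrb 1 x
  have b2 : ∀ x, |r 2 x| ≤ 6 := fun x => (hrb 2 x).trans_eq (by norm_num [Nat.factorial])
  have b3 : ∀ x, |r 3 x| ≤ 18 := fun x => (hrb 3 x).trans_eq (by norm_num [Nat.factorial])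
  -- The third derivative is at most `18 + 3·18 + 2·27 = 126 = 2·63`, the second at most `6 + 9 ≤
  -- 63`.
  have := abs_taylor_two_le (C := 63) hl h1 h2 (fun y => ?_) (fun y => ?_) x
  · simpa only [hZ0, Complex.ofReal_zero, show (2 : ℝ) * 63 = 126 by norm_num] using this
  · have e1 := abs_sub (r (1 + 1) y) (r 1 y * r 1 y)
    have e2 : |r 1 y| * |r 1 y| ≤ 3 * 3 := by gcongr <;> exact b1 y
    rw [abs_mul] at e1
    linarith [b2 y]
  · have e1 := abs_add_le (r 3 y - 3 * r 1 y * r 2 y) (2 * r 1 y ^ 3)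
    have e2 := abs_sub (r 3 y) (3 * r 1 y * r 2 y)
    have e3 : |r 1 y| * |r 2 y| ≤ 3 * 6 := by gcongr; exacts [b1 y, b2 y]
    have e4 : |r 1 y| ^ 3 ≤ 3 ^ 3 := by gcongr; exact b1 y
    rw [abs_mul, abs_pow] at e1
    rw [abs_mul, abs_mul] at e2
    norm_num at e1 e2 e3 e4 ⊢
    linarith [b3 y]

end Taylor

/-! ### Perturbing the Hamiltonian by one term -/

section LogPartitionFunction

variable {n : ℕ} {A P : Operator n}

theorem isHermitian_add_ofReal_smul (hA : A.IsHermitian) (hP : P.IsHermitian) (x : ℝ) :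
    (A + (x : ℂ) • P).IsHermitian := by
  refine hA.add ?_
  rw [Matrix.IsHermitian, Matrix.conjTranspose_smul, hP.eq, Complex.star_def, Complex.conj_ofReal]

open scoped Matrix.Norms.Operator in
-- By Bernstein's inequality only the Hermitian part `A + (Re z) P` matters, and moving `Re z` to
-- `x` changes energies by at most `|Re z - x|`.
theorem norm_trace_exp_add_smul_le (hA : A.IsHermitian) (hP : P.IsHermitian)
    (hE : ∀ φ, ‖φ‖ = 1 → |energy P φ| ≤ 1) (z : ℂ) (x : ℝ) :
    ‖(NormedSpace.exp (A + z • P)).trace‖ ≤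
      Real.exp |z.re - x| * partitionFunction (A + (x : ℂ) • P) := by
  refine (norm_trace_exp_le _).trans ?_
  have e : (1 / 2 : ℝ) • (A + z • P) + (1 / 2 : ℝ) • (A + z • P).conjTranspose =
      A + (z.re : ℂ) • P := by
    ext i j
    have hA' := congrFun (congrFun hA.eq i) j
    have hP' := congrFun (congrFun hP.eq i) j
    simp only [Matrix.add_apply, Matrix.smul_apply, Matrix.conjTranspose_add,
      Matrix.conjTranspose_smul, hA', hP', Complex.real_smul, smul_eq_mul, Complex.star_def,
      Complex.re_eq_add_conj]
    push_cast
    ring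
  rw [e]
  refine partitionFunction_le (isHermitian_add_ofReal_smul hA hP _)
    (isHermitian_add_ofReal_smul hA hP _) fun φ hφ => ?_
  rw [energy_add, energy_add, energy_smul, energy_smul]
  have : (z.re - x) * energy P φ ≤ |z.re - x| * 1 := (le_abs_self _).trans (by
    rw [abs_mul]
    gcongr
    exact hE φ hφ)
  linarith

open scoped Matrix.Norms.Operator in
theorem differentiable_trace_exp_add_smul (A P : Operator n) :
    Differentiable ℂ fun z : ℂ => (NormedSpace.exp (A + z • P)).trace := by
  have h1 : Differentiable ℂ fun z : ℂ => NormedSpace.exp (A + z • P) := fun z =>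
    (NormedSpace.exp_analytic (𝕂 := ℂ) (A + z • P)).differentiableAt.comp z (by fun_prop)
  let T : Operator n →L[ℂ] ℂ := LinearMap.toContinuousLinearMap (Matrix.traceLinearMap _ ℂ ℂ)
  exact T.differentiable.comp h1

/-- The second order Taylor expansion of `log tr exp(A + x P)`. -/
theorem exists_abs_log_partitionFunction_taylor_le (hA : A.IsHermitian) (hP : P.IsHermitian)
    (hE : ∀ φ, ‖φ‖ = 1 → |energy P φ| ≤ 1) :
    ∃ a b : ℝ, ∀ x : ℝ, |Real.log (partitionFunction (A + (x : ℂ) • P)) -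
      Real.log (partitionFunction A) - a * x - b * x ^ 2| ≤ 126 * min (x ^ 2) (|x| ^ 3) := by
  obtain ⟨a, b, h⟩ := exists_abs_log_taylor_le (differentiable_trace_exp_add_smul A P)
    (fun x => partitionFunction_pos (isHermitian_add_ofReal_smul hA hP x))
    (norm_trace_exp_add_smul_le hA hP hE)
  exact ⟨a, b, fun x => by simpa [partitionFunction] using h x⟩

open scoped Matrix.Norms.Operator in
theorem continuous_partitionFunction : Continuous (partitionFunction : Operator n → ℝ) :=
  Complex.continuous_re.comp (NormedSpace.exp_continuous.matrix_trace)

end LogPartitionFunction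

/-! ### Pauli strings are Hermitian involutions -/

section PauliStrings

open Matrix

variable {n p : ℕ}

/-- The tensor product of one-qubit operators. -/
def siteTensor (M : Fin n → Matrix (Fin 2) (Fin 2) ℂ) : Operator n :=
  Matrix.of fun s t => ∏ j, M j (s j) (t j)

theorem siteTensor_mul (M N : Fin n → Matrix (Fin 2) (Fin 2) ℂ) :
    siteTensor M * siteTensor N = siteTensor fun j => M j * N j := by
  ext s t
  simp only [siteTensor, Matrix.mul_apply, Matrix.of_apply, ← Finset.prod_mul_distrib,
    Finset.prod_univ_sum, Fintype.piFinset_univ]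

theorem siteTensor_one : siteTensor (fun _ : Fin n => 1) = 1 := by
  ext s t
  simp only [siteTensor, Matrix.of_apply, Matrix.one_apply, Finset.prod_ite_zero,
    Finset.prod_const_one, Finset.mem_univ, true_imp_iff, funext_iff]

theorem conjTranspose_siteTensor (M : Fin n → Matrix (Fin 2) (Fin 2) ℂ) :
    (siteTensor M)ᴴ = siteTensor fun j => (M j)ᴴ := by
  ext s t
  simp [siteTensor]

theorem sitePauli_eq_siteTensor (i : Fin n) (a : Fin 4) :
    sitePauli i a = siteTensor fun j => pauli (Function.update (fun _ => (0 : Fin 4)) i a j) := rfl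

theorem isHermitian_pauli (a : Fin 4) : (pauli a).IsHermitian := by
  fin_cases a <;> ext i j <;> fin_cases i <;> fin_cases j <;> simp [pauli]

theorem pauli_mul_self (a : Fin 4) : pauli a * pauli a = 1 := by
  fin_cases a <;> ext i j <;> fin_cases i <;> fin_cases j <;> simp [pauli, Matrix.mul_apply]

theorem isHermitian_sitePauli (i : Fin n) (a : Fin 4) : (sitePauli i a).IsHermitian := by
  rw [Matrix.IsHermitian, sitePauli_eq_siteTensor, conjTranspose_siteTensor]
  simp only [(isHermitian_pauli _).eq]

theorem sitePauli_mul_self (i : Fin n) (a : Fin 4) : sitePauli i a * sitePauli i a = 1 := by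
  simp only [sitePauli_eq_siteTensor, siteTensor_mul, pauli_mul_self, siteTensor_one]

theorem commute_sitePauli {i j : Fin n} (h : i ≠ j) (a b : Fin 4) :
    Commute (sitePauli i a) (sitePauli j b) := by
  rw [Commute, SemiconjBy, sitePauli_eq_siteTensor, sitePauli_eq_siteTensor, siteTensor_mul,
    siteTensor_mul]
  congr 1
  funext k
  have h0 : pauli 0 = 1 := rfl
  by_cases hk : k = i
  · subst hk
    simp [Function.update_of_ne h, h0]
  · simp [Function.update_of_ne hk, h0]

theorem pairwise_commute_sitePauli (e : Term n p) :
    (List.ofFn fun k : Fin p => sitePauli (e.1.1 k) (e.2 k).succ).Pairwise Commute := by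
  rw [List.pairwise_ofFn]
  exact fun k l hkl => commute_sitePauli (e.1.2 k l hkl).ne _ _

theorem isHermitian_pauliString (e : Term n p) : (pauliString e).IsHermitian := by
  rw [Matrix.IsHermitian, pauliString, Matrix.conjTranspose_list_prod, List.map_ofFn]
  have : (conjTranspose ∘ fun k : Fin p => sitePauli (e.1.1 k) (e.2 k).succ) =
      fun k => sitePauli (e.1.1 k) (e.2 k).succ := funext fun k => (isHermitian_sitePauli _ _).eq
  rw [this]
  exact (List.Perm.prod_eq' (List.reverse_perm _).symm (pairwise_commute_sitePauli e)).symm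

theorem pauliString_mem_unitary (e : Term n p) : pauliString e ∈ unitary (Operator n) := by
  refine Submonoid.list_prod_mem _ fun M hM => ?_
  obtain ⟨k, rfl⟩ := List.mem_ofFn.1 hM
  rw [Unitary.mem_iff, Matrix.star_eq_conjTranspose, (isHermitian_sitePauli _ _).eq,
    sitePauli_mul_self]
  exact ⟨rfl, rfl⟩

theorem pauliString_mul_self (e : Term n p) : pauliString e * pauliString e = 1 := by
  have := (Unitary.mem_iff.1 (pauliString_mem_unitary e)).1
  rwa [Matrix.star_eq_conjTranspose, (isHermitian_pauliString e).eq] at this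

/-- A Hermitian involution is an isometry, so Cauchy-Schwarz applies. -/
theorem abs_energy_le_one {P : Operator n} (hP : P.IsHermitian) (hPP : P * P = 1)
    {φ : EuclideanSpace ℂ (Fin n → Fin 2)} (hφ : ‖φ‖ = 1) : |energy P φ| ≤ 1 := by
  have hs : (Matrix.toEuclideanLin P).IsSymmetric := Matrix.isSymmetric_toEuclideanLin_iff.2 hP
  have h1 : ‖Matrix.toEuclideanLin P φ‖ ^ 2 = 1 := by
    have h2 : Matrix.toEuclideanLin P (Matrix.toEuclideanLin P φ) = φ := by
      simp [Matrix.toLpLin_apply, hPP]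
    have h3 := inner_self_eq_norm_sq_to_K (𝕜 := ℂ) (Matrix.toEuclideanLin P φ)
    rw [hs, h2, inner_self_eq_norm_sq_to_K, hφ] at h3
    have h4 : ((‖Matrix.toEuclideanLin P φ‖ ^ 2 : ℝ) : ℂ) = ((1 : ℝ) : ℂ) := by
      push_cast
      simpa using h3.symm
    exact_mod_cast h4
  have h5 : ‖Matrix.toEuclideanLin P φ‖ = 1 := by
    rwa [pow_eq_one_iff_of_nonneg (norm_nonneg _) two_ne_zero] at h1
  refine (Complex.abs_re_le_norm _).trans ((norm_inner_le_norm _ _).trans ?_)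
  rw [h5, hφ, one_mul]

theorem abs_energy_pauliString_le_one (e : Term n p) {φ : EuclideanSpace ℂ (Fin n → Fin 2)}
    (hφ : ‖φ‖ = 1) : |energy (pauliString e) φ| ≤ 1 :=
  abs_energy_le_one (isHermitian_pauliString e) (pauliString_mul_self e) hφ

end PauliStrings

/-! ### Energy and free energy as functions of the coefficients -/

section Hamiltonian

variable {n p : ℕ}

theorem isHermitian_ofReal_smul {A : Operator n} (hA : A.IsHermitian) (r : ℝ) :
    ((r : ℂ) • A).IsHermitian := by
  simpa using isHermitian_add_ofReal_smul (A := 0) Matrix.isHermitian_zero hA r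

theorem hamiltonian_eq_sum (α : Term n p → ℝ) :
    hamiltonian n p α = ((1 / Real.sqrt (n.choose p) : ℝ) : ℂ) •
      ∑ e : Term n p, (α e : ℂ) • pauliString e := by
  rw [hamiltonian, Fintype.sum_prod_type]

theorem isHermitian_hamiltonian (α : Term n p → ℝ) : (hamiltonian n p α).IsHermitian := by
  rw [hamiltonian_eq_sum]
  refine isHermitian_ofReal_smul ?_ _
  refine Finset.sum_induction _ Matrix.IsHermitian (fun _ _ ha hb => ha.add hb)
    Matrix.isHermitian_zero fun e _ => isHermitian_ofReal_smul (isHermitian_pauliString e) _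

theorem hamiltonian_update (α : Term n p → ℝ) (e : Term n p) (x : ℝ) :
    hamiltonian n p (Function.update α e x) = hamiltonian n p (Function.update α e 0) +
      ((1 / Real.sqrt (n.choose p) * x : ℝ) : ℂ) • pauliString e := by
  rw [hamiltonian_eq_sum, hamiltonian_eq_sum, Complex.ofReal_mul, mul_smul, ← smul_add]
  congr 1
  rw [← Finset.add_sum_erase _ _ (Finset.mem_univ e),
    ← Finset.add_sum_erase Finset.univ (fun e' => ((Function.update α e 0 e' : ℝ) : ℂ) • pauliString e')
      (Finset.mem_univ e), Function.update_self, Function.update_self, Complex.ofReal_zero, zero_smul,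
    zero_add, add_comm]
  congr 1
  refine Finset.sum_congr rfl fun e' he' => ?_
  rw [Function.update_of_ne (Finset.ne_of_mem_erase he'),
    Function.update_of_ne (Finset.ne_of_mem_erase he')]

theorem energy_hamiltonian (α : Term n p → ℝ) (φ : EuclideanSpace ℂ (Fin n → Fin 2)) :
    energy (hamiltonian n p α) φ =
      1 / Real.sqrt (n.choose p) * ∑ e, α e * energy (pauliString e) φ := by
  rw [hamiltonian_eq_sum, energy_smul, energy_sum]
  simp only [energy_smul]

theorem maxEnergy_hamiltonian_le (α α' : Term n p → ℝ) :
    maxEnergy (hamiltonian n p α) ≤ maxEnergy (hamiltonian n p α') +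
      1 / Real.sqrt (n.choose p) * ∑ e, |α e - α' e| := by
  obtain ⟨φ, hφ, h⟩ := exists_energy_eq_maxEnergy (hamiltonian n p α)
  have h1 := energy_le_maxEnergy (hamiltonian n p α') hφ
  rw [← h]
  have h2 : energy (hamiltonian n p α) φ - energy (hamiltonian n p α') φ ≤
      1 / Real.sqrt (n.choose p) * ∑ e, |α e - α' e| := by
    rw [energy_hamiltonian, energy_hamiltonian, ← mul_sub, ← Finset.sum_sub_distrib]
    refine mul_le_mul_of_nonneg_left (Finset.sum_le_sum fun e _ => ?_) (by positivity)
    rw [← sub_mul]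
    refine (le_abs_self _).trans ?_
    rw [abs_mul]
    exact mul_le_of_le_one_right (abs_nonneg _) (abs_energy_pauliString_le_one e hφ)
  linarith

/-- Testing one Hamiltonian in the optimal state of the other. Continuity and integrability both
follow from this Lipschitz bound. -/
theorem abs_normalizedMaxEnergy_sub_le (α α' : Term n p → ℝ) :
    |normalizedMaxEnergy n p α - normalizedMaxEnergy n p α'| ≤
      1 / Real.sqrt n * (1 / Real.sqrt (n.choose p)) * ∑ e, |α e - α' e| := by
  rw [normalizedMaxEnergy, normalizedMaxEnergy, ← mul_sub, abs_mul,
    abs_of_nonneg (by positivity : 0 ≤ 1 / Real.sqrt n), mul_assoc]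
  refine mul_le_mul_of_nonneg_left (abs_le.2 ⟨?_, ?_⟩) (by positivity)
  · have := maxEnergy_hamiltonian_le α' α
    simp only [abs_sub_comm (α' _)] at this
    linarith
  · linarith [maxEnergy_hamiltonian_le α α']

theorem continuous_normalizedMaxEnergy : Continuous (normalizedMaxEnergy n p) := by
  rw [continuous_iff_continuousAt]
  intro α
  rw [ContinuousAt, tendsto_iff_norm_sub_tendsto_zero]
  refine squeeze_zero (fun _ => norm_nonneg _) (fun α' => abs_normalizedMaxEnergy_sub_le α' α) ?_
  have : Continuous fun α' : Term n p → ℝ =>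
      1 / Real.sqrt n * (1 / Real.sqrt (n.choose p)) * ∑ e, |α' e - α e| := by fun_prop
  simpa using this.tendsto α

theorem normalizedMaxEnergy_zero : normalizedMaxEnergy n p 0 = 0 := by
  obtain ⟨φ, -, h⟩ := exists_energy_eq_maxEnergy (hamiltonian n p 0)
  rw [normalizedMaxEnergy, ← h, energy_hamiltonian]
  simp

theorem abs_normalizedMaxEnergy_le (α : Term n p → ℝ) :
    |normalizedMaxEnergy n p α| ≤
      1 / Real.sqrt n * (1 / Real.sqrt (n.choose p)) * ∑ e, |α e| := by
  simpa [normalizedMaxEnergy_zero] using abs_normalizedMaxEnergy_sub_le α 0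

theorem maxEnergy_smul (A : Operator n) {r : ℝ} (hr : 0 ≤ r) :
    maxEnergy ((r : ℂ) • A) = r * maxEnergy A := by
  apply le_antisymm
  · obtain ⟨φ, hφ, h⟩ := exists_energy_eq_maxEnergy ((r : ℂ) • A)
    rw [← h, energy_smul]
    exact mul_le_mul_of_nonneg_left (energy_le_maxEnergy A hφ) hr
  · obtain ⟨φ, hφ, h⟩ := exists_energy_eq_maxEnergy A
    rw [← h, ← energy_smul]
    exact energy_le_maxEnergy _ hφ

/-- The free energy at inverse temperature `β`, normalized as `normalizedMaxEnergy`. -/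
noncomputable def freeEnergy (β : ℝ) (n p : ℕ) (α : Term n p → ℝ) : ℝ :=
  1 / (β * n) * Real.log (partitionFunction (((β * Real.sqrt n : ℝ) : ℂ) • hamiltonian n p α))

theorem abs_freeEnergy_sub_normalizedMaxEnergy_le {β : ℝ} (hβ : 0 < β) (hn : 0 < n)
    (α : Term n p → ℝ) :
    |freeEnergy β n p α - normalizedMaxEnergy n p α| ≤ Real.log 2 / β := by
  have hn' : (0 : ℝ) < n := by exact_mod_cast hn
  have h := abs_log_partitionFunction_sub_maxEnergy_le
    (isHermitian_ofReal_smul (isHermitian_hamiltonian α) (β * Real.sqrt n))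
  rw [maxEnergy_smul _ (by positivity)] at h
  -- The factor `β√n` in the exponent is chosen because `1/√n = √n/n`.
  have e : normalizedMaxEnergy n p α =
      1 / (β * n) * (β * Real.sqrt n * maxEnergy (hamiltonian n p α)) := by
    rw [normalizedMaxEnergy]
    have : Real.sqrt n ≠ 0 := by positivity
    field_simp
    rw [Real.sq_sqrt hn'.le, mul_comm]
  rw [freeEnergy, e, ← mul_sub, abs_mul, abs_of_pos (by positivity : 0 < 1 / (β * n))]
  refine (mul_le_mul_of_nonneg_left h (by positivity)).trans (le_of_eq ?_)
  field_simp

theorem continuous_hamiltonian : Continuous (hamiltonian n p) := by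
  have : hamiltonian n p = fun α => ((1 / Real.sqrt (n.choose p) : ℝ) : ℂ) •
      ∑ e : Term n p, (α e : ℂ) • pauliString e := funext hamiltonian_eq_sum
  rw [this]
  fun_prop

theorem continuous_freeEnergy (β : ℝ) : Continuous (freeEnergy β n p) := by
  unfold freeEnergy
  refine continuous_const.mul (Continuous.log ?_ fun α => (partitionFunction_pos
    (isHermitian_ofReal_smul (isHermitian_hamiltonian α) _)).ne')
  exact continuous_partitionFunction.comp
    (continuous_hamiltonian.const_smul ((β * Real.sqrt n : ℝ) : ℂ))

theorem exists_abs_freeEnergy_taylor_le {β : ℝ} (hβ : 0 < β) (α : Term n p → ℝ) (e : Term n p) :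
    ∃ a b : ℝ, ∀ x : ℝ, |freeEnergy β n p (Function.update α e x) -
        freeEnergy β n p (Function.update α e 0) - a * x - b * x ^ 2| ≤
      126 / (β * n) * min ((β * Real.sqrt n / Real.sqrt (n.choose p) * x) ^ 2)
        (|β * Real.sqrt n / Real.sqrt (n.choose p) * x| ^ 3) := by
  set t := β * Real.sqrt n / Real.sqrt (n.choose p) with ht
  obtain ⟨a, b, h⟩ := exists_abs_log_partitionFunction_taylor_le
    (isHermitian_ofReal_smul (isHermitian_hamiltonian (Function.update α e 0)) (β * Real.sqrt n))
    (isHermitian_pauliString e) (fun φ hφ => abs_energy_pauliString_le_one e hφ)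
  refine ⟨1 / (β * n) * (a * t), 1 / (β * n) * (b * t ^ 2), fun x => ?_⟩
  have h0 : 0 ≤ 1 / (β * n) := by positivity
  have e1 : ((β * Real.sqrt n : ℝ) : ℂ) • hamiltonian n p (Function.update α e x) =
      ((β * Real.sqrt n : ℝ) : ℂ) • hamiltonian n p (Function.update α e 0) +
        ((t * x : ℝ) : ℂ) • pauliString e := by
    rw [hamiltonian_update, smul_add, smul_smul, ← Complex.ofReal_mul]
    congr 3
    rw [ht]
    ring
  have := mul_le_mul_of_nonneg_left (h (t * x)) h0
  rw [freeEnergy, freeEnergy, e1]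
  rw [← abs_of_nonneg h0, ← abs_mul, abs_of_nonneg h0] at this
  refine (le_of_eq ?_).trans (this.trans (le_of_eq ?_))
  · congr 1
    ring
  · ring

end Hamiltonian

/-! ### Lindeberg's replacement method -/

section Lindeberg

variable {ι : Type*} [Fintype ι]

/-- Overwriting coordinate `e` by an independent variable: this lets Fubini isolate that coordinate
while the index type stays fixed. -/
theorem map_update_pi_prod [DecidableEq ι] (μ : ι → Measure ℝ) [∀ i, IsProbabilityMeasure (μ i)] (e : ι)
    (ν : Measure ℝ) [IsProbabilityMeasure ν] :
    ((Measure.pi μ).prod ν).map (fun q : (ι → ℝ) × ℝ => Function.update q.1 e q.2) =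
      Measure.pi (Function.update μ e ν) := by
  have hprob : ∀ i, IsProbabilityMeasure (Function.update μ e ν i) := fun i => by
    by_cases h : i = e
    · subst h
      simpa only [Function.update_self]
    · simp only [Function.update_of_ne h]
      infer_instance
  have hm : Measurable fun q : (ι → ℝ) × ℝ => Function.update q.1 e q.2 :=
    measurable_update'
  refine (Measure.pi_eq fun s hs => ?_).symm
  rw [Measure.map_apply hm (MeasurableSet.univ_pi hs)]
  have : (fun q : (ι → ℝ) × ℝ => Function.update q.1 e q.2) ⁻¹' Set.univ.pi s =
      (Set.univ.pi (Function.update s e Set.univ)) ×ˢ s e := by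
    ext q
    simp only [Set.mem_preimage, Set.mem_pi, Set.mem_univ, true_imp_iff, Set.mem_prod]
    constructor
    · intro h
      refine ⟨fun i => ?_, by simpa using h e⟩
      by_cases hi : i = e
      · subst hi; simp
      · simpa [Function.update_of_ne hi] using h i
    · rintro ⟨h, he⟩ i
      by_cases hi : i = e
      · subst hi; simpa using he
      · simpa [Function.update_of_ne hi] using h i
  rw [this, Measure.prod_prod, Measure.pi_pi,
    ← Finset.mul_prod_erase _ _ (Finset.mem_univ e),
    ← Finset.mul_prod_erase Finset.univ (fun i => Function.update μ e ν i (s i)) (Finset.mem_univ e)]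
  simp only [Function.update_self, measure_univ, one_mul]
  rw [mul_comm]
  congr 1
  refine Finset.prod_congr rfl fun i hi => ?_
  rw [Function.update_of_ne (Finset.ne_of_mem_erase hi),
    Function.update_of_ne (Finset.ne_of_mem_erase hi)]

theorem integrable_eval_of_sq {μ : ι → Measure ℝ} [∀ i, IsProbabilityMeasure (μ i)]
    (h2 : ∀ i, Integrable (fun x => x ^ 2) (μ i)) (i : ι) :
    Integrable (fun α : ι → ℝ => α i) (Measure.pi μ) := by
  have h1 : Integrable (fun x : ℝ => x) (μ i) :=
    ((memLp_two_iff_integrable_sq measurable_id.aestronglyMeasurable).2 (h2 i)).integrable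
      one_le_two
  exact (measurePreserving_eval μ i).integrable_comp_of_integrable h1

theorem integrable_pi_of_abs_le {μ : ι → Measure ℝ} [∀ i, IsProbabilityMeasure (μ i)]
    (h2 : ∀ i, Integrable (fun x => x ^ 2) (μ i)) {f : (ι → ℝ) → ℝ} (hf : Continuous f) {K L : ℝ}
    (hb : ∀ α, |f α| ≤ K + L * ∑ i, |α i|) : Integrable f (Measure.pi μ) := by
  refine Integrable.mono' (g := fun α => K + L * ∑ i, |α i|) ?_ hf.aestronglyMeasurable
    (Eventually.of_forall hb)
  exact (integrable_const K).add
    ((integrable_finsetSum _ fun i _ => (integrable_eval_of_sq h2 i).abs).const_mul L)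

/-- If `φ` is close to a quadratic polynomial, its integral is close to the integral of that
polynomial, which only depends on the first two moments. -/
theorem abs_integral_sub_le {μ : Measure ℝ} [IsProbabilityMeasure μ] {φ R : ℝ → ℝ} {c a b : ℝ}
    (h1 : ∫ x, x ∂μ = 0) (h2 : ∫ x, x ^ 2 ∂μ = 1) (hφ : Integrable φ μ) (hR : Integrable R μ)
    (h : ∀ x, |φ x - c - a * x - b * x ^ 2| ≤ R x) :
    |∫ x, φ x ∂μ - (c + b)| ≤ ∫ x, R x ∂μ := by
  have i2 : Integrable (fun x : ℝ => x ^ 2) μ := by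
    by_contra hn
    rw [integral_undef hn] at h2
    exact zero_ne_one h2
  have i1 : Integrable (fun x : ℝ => x) μ :=
    ((memLp_two_iff_integrable_sq measurable_id.aestronglyMeasurable).2 i2).integrable one_le_two
  have e : ∫ x, φ x ∂μ - (c + b) = ∫ x, (φ x - c - a * x - b * x ^ 2) ∂μ := by
    rw [integral_sub, integral_sub, integral_sub hφ (integrable_const c), integral_const_mul,
      integral_const_mul, h1, h2]
    · simp; ring
    · exact hφ.sub (integrable_const c)
    · exact i1.const_mul a
    · exact (hφ.sub (integrable_const c)).sub (i1.const_mul a)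
    · exact i2.const_mul b
  rw [e]
  exact (norm_integral_le_integral_norm _).trans (integral_mono_of_nonneg
    (Eventually.of_forall fun _ => norm_nonneg _) hR
      (Eventually.of_forall fun x => (Real.norm_eq_abs _).trans_le (h x)))

/-- One step of Lindeberg's replacement argument. -/
theorem abs_integral_update_sub_le [DecidableEq ι] {μ : ι → Measure ℝ} [∀ i, IsProbabilityMeasure (μ i)]
    (e : ι) {ν ν' : Measure ℝ} [IsProbabilityMeasure ν] [IsProbabilityMeasure ν']
    (h1 : ∫ x, x ∂ν = 0) (h2 : ∫ x, x ^ 2 ∂ν = 1) (h1' : ∫ x, x ∂ν' = 0)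
    (h2' : ∫ x, x ^ 2 ∂ν' = 1) {f : (ι → ℝ) → ℝ} (hf : Continuous f)
    (hfi : Integrable f (Measure.pi (Function.update μ e ν)))
    (hfi' : Integrable f (Measure.pi (Function.update μ e ν'))) {R : ℝ → ℝ}
    (hR : Integrable R ν) (hR' : Integrable R ν')
    (h : ∀ α : ι → ℝ, ∃ a b : ℝ, ∀ x, |f (Function.update α e x) - f (Function.update α e 0)
      - a * x - b * x ^ 2| ≤ R x) :
    |∫ α, f α ∂(Measure.pi (Function.update μ e ν)) -
      ∫ α, f α ∂(Measure.pi (Function.update μ e ν'))| ≤ ∫ x, R x ∂ν + ∫ x, R x ∂ν' := by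
  have hm : Measurable fun q : (ι → ℝ) × ℝ => Function.update q.1 e q.2 :=
    measurable_update'
  rw [← map_update_pi_prod] at hfi hfi' ⊢
  rw [← map_update_pi_prod μ e ν', integral_map hm.aemeasurable hf.aestronglyMeasurable,
    integral_map hm.aemeasurable hf.aestronglyMeasurable]
  rw [integrable_map_measure hf.aestronglyMeasurable hm.aemeasurable] at hfi hfi'
  simp only [Function.comp_def] at hfi hfi'
  rw [integral_prod _ hfi, integral_prod _ hfi', ← integral_sub hfi.integral_prod_left
    hfi'.integral_prod_left]
  have hae : ∀ᵐ α ∂(Measure.pi μ), ‖∫ x, f (Function.update α e x) ∂ν -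
      ∫ x, f (Function.update α e x) ∂ν'‖ ≤ ∫ x, R x ∂ν + ∫ x, R x ∂ν' := by
    filter_upwards [hfi.prod_right_ae, hfi'.prod_right_ae] with α hα hα'
    obtain ⟨a, b, hab⟩ := h α
    have e1 := abs_integral_sub_le h1 h2 hα hR hab
    have e2 := abs_integral_sub_le h1' h2' hα' hR' hab
    rw [Real.norm_eq_abs]
    rw [abs_le] at *
    constructor <;> linarith [e1.1, e1.2, e2.1, e2.2]
  simpa using norm_integral_le_of_norm_le_const hae

/-- Lindeberg's replacement argument. -/
theorem abs_integral_pi_sub_le [DecidableEq ι] {μ ν : ι → Measure ℝ} [∀ i, IsProbabilityMeasure (μ i)]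
    [∀ i, IsProbabilityMeasure (ν i)] (h1 : ∀ i, ∫ x, x ∂(μ i) = 0)
    (h2 : ∀ i, ∫ x, x ^ 2 ∂(μ i) = 1) (h1' : ∀ i, ∫ x, x ∂(ν i) = 0)
    (h2' : ∀ i, ∫ x, x ^ 2 ∂(ν i) = 1) {f : (ι → ℝ) → ℝ} (hf : Continuous f) {K L : ℝ}
    (hb : ∀ α, |f α| ≤ K + L * ∑ i, |α i|) {R : ℝ → ℝ}
    (hR : ∀ i, Integrable R (μ i)) (hR' : ∀ i, Integrable R (ν i))
    (h : ∀ (α : ι → ℝ) (e : ι), ∃ a b : ℝ, ∀ x, |f (Function.update α e x) -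
      f (Function.update α e 0) - a * x - b * x ^ 2| ≤ R x) :
    |∫ α, f α ∂(Measure.pi μ) - ∫ α, f α ∂(Measure.pi ν)| ≤
      ∑ i, (∫ x, R x ∂(μ i) + ∫ x, R x ∂(ν i)) := by
  -- Hybrid laws, with `μ` on `s` and `ν` elsewhere; inserting an index exchanges one coordinate.
  have key : ∀ s : Finset ι, |∫ α, f α ∂(Measure.pi (s.piecewise μ ν)) -
      ∫ α, f α ∂(Measure.pi ν)| ≤ ∑ i ∈ s, (∫ x, R x ∂(μ i) + ∫ x, R x ∂(ν i)) := by
    intro s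
    induction s using Finset.induction_on with
    | empty => simp
    | insert e s he ih =>
      have hpw : ∀ (s : Finset ι) i, IsProbabilityMeasure (s.piecewise μ ν i) := fun s i => by
        by_cases hi : i ∈ s <;> simp [hi] <;> infer_instance
      have hsq : ∀ (s : Finset ι) i, Integrable (fun x => x ^ 2) (s.piecewise μ ν i) := fun s i => by
        by_contra hn
        have h0 := integral_undef hn
        by_cases hi : i ∈ s <;> simp [hi, h2, h2'] at h0
      have e1 : Function.update (s.piecewise μ ν) e (μ e) = (insert e s).piecewise μ ν :=
        (Finset.piecewise_insert s μ ν e).symm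
      have e2 : Function.update (s.piecewise μ ν) e (ν e) = s.piecewise μ ν := by
        rw [Function.update_eq_self_iff, Finset.piecewise_eq_of_notMem _ _ _ he]
      have step := abs_integral_update_sub_le (μ := s.piecewise μ ν) e (h1 e) (h2 e) (h1' e) (h2' e)
        hf (by rw [e1]; exact integrable_pi_of_abs_le (hsq _) hf hb)
        (by rw [e2]; exact integrable_pi_of_abs_le (hsq _) hf hb) (hR e) (hR' e) fun α => h α e
      rw [e1, e2] at step
      rw [Finset.sum_insert he]
      exact (abs_sub_le _ _ _).trans (add_le_add step ih)
  simpa using key Finset.univ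

end Lindeberg

/-! ### Counting the terms -/

section Counting

variable {n p : ℕ}

theorem card_incTuple (n p : ℕ) : Fintype.card (IncTuple n p) = n.choose p := by
  let e : IncTuple n p ≃ (Fin p ↪o Fin n) :=
    { toFun := fun i => OrderEmbedding.ofStrictMono i.1 fun j k h => i.2 j k h
      invFun := fun f => ⟨f, fun _ _ h => f.strictMono h⟩
      left_inv := fun _ => rfl
      right_inv := fun _ => rfl }
  rw [← Nat.card_eq_fintype_card, Nat.card_congr (e.trans Set.powersetCard.ofFinEmbEquiv),
    Set.powersetCard.card, Nat.card_eq_fintype_card, Fintype.card_fin]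

theorem card_term (n p : ℕ) : Fintype.card (Term n p) = n.choose p * 3 ^ p := by
  rw [Fintype.card_prod, card_incTuple, Fintype.card_fun, Fintype.card_fin, Fintype.card_fin]

theorem isEmpty_term (h : n < p) : IsEmpty (Term n p) := by
  rw [← Fintype.card_eq_zero_iff, card_term, Nat.choose_eq_zero_of_lt h, zero_mul]

/-- For `n ≥ 2p` each factor of the falling factorial is at least `n/2`. -/
theorem pow_le_mul_choose (h : 2 * p ≤ n) :
    (n : ℝ) ^ p ≤ 2 ^ p * p.factorial * n.choose p := by
  have h1 := Nat.pow_le_choose (α := ℝ) p n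
  rw [div_le_iff₀ (by positivity)] at h1
  calc (n : ℝ) ^ p ≤ (2 * (n + 1 - p : ℕ)) ^ p := by
        gcongr
        exact_mod_cast (by omega : n ≤ 2 * (n + 1 - p))
    _ = 2 ^ p * ((n + 1 - p : ℕ) : ℝ) ^ p := mul_pow _ _ _
    _ ≤ 2 ^ p * (n.choose p * p.factorial) := by gcongr
    _ = _ := by ring

end Counting

/-! ### Comparison of two disorders -/

section Comparison

variable {p : ℕ} {D D' : ∀ n : ℕ, Term n p → Measure ℝ}

theorem DisorderConditions.integrable_sq (h : DisorderConditions p D) (n : ℕ) (e : Term n p) :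
    Integrable (fun x => x ^ 2) (D n e) := by
  by_contra hn
  have := h.second_moment n e
  rw [integral_undef hn] at this
  exact zero_ne_one this

theorem DisorderConditions.integrable_normalizedMaxEnergy (h : DisorderConditions p D) (n : ℕ) :
    Integrable (normalizedMaxEnergy n p) (disorder (D n)) := by
  have := h.isProbability n
  refine integrable_pi_of_abs_le (h.integrable_sq n) continuous_normalizedMaxEnergy (K := 0)
    (L := 1 / Real.sqrt n * (1 / Real.sqrt (n.choose p))) fun α => ?_
  rw [zero_add]
  exact abs_normalizedMaxEnergy_le α

/-- The averaged truncated second moments in the condition `DisorderConditions.boundedness`. -/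
noncomputable def averageTail (D : ∀ n : ℕ, Term n p → Measure ℝ) (ε : ℝ) (n : ℕ) : ℝ :=
  1 / (n.choose p : ℝ) * ∑ i : IncTuple n p, ∑ a : Fin p → Fin 3,
    ∫ x in {x : ℝ | (n : ℝ) ^ (((p : ℝ) - 1) / 2) * ε < |x|}, x ^ 2 ∂(D n (i, a))

theorem measurableSet_lt_abs (τ : ℝ) : MeasurableSet {x : ℝ | τ < |x|} :=
  measurableSet_lt measurable_const measurable_id.abs

theorem integrable_min_sq_cube {μ : Measure ℝ} (h : Integrable (fun x => x ^ 2) μ) (t : ℝ) :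
    Integrable (fun x => min ((t * x) ^ 2) (|t * x| ^ 3)) μ := by
  refine Integrable.mono' (h.const_mul (t ^ 2)) (by fun_prop) (Eventually.of_forall fun x => ?_)
  rw [Real.norm_of_nonneg (by positivity), ← mul_pow]
  exact min_le_left _ _

/-- Use the square where `|x| > τ`, and the cube with `|x|³ ≤ τx²` elsewhere. -/
theorem integral_min_sq_cube_le {μ : Measure ℝ} (h : Integrable (fun x => x ^ 2) μ)
    (h2 : ∫ x, x ^ 2 ∂μ = 1) {t τ : ℝ} (ht : 0 ≤ t) (hτ : 0 ≤ τ) :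
    ∫ x, min ((t * x) ^ 2) (|t * x| ^ 3) ∂μ ≤
      t ^ 2 * ∫ x in {x : ℝ | τ < |x|}, x ^ 2 ∂μ + t ^ 3 * τ := by
  have hi : Integrable ({x : ℝ | τ < |x|}.indicator fun x => x ^ 2) μ :=
    h.indicator (measurableSet_lt_abs τ)
  have e : t ^ 2 * ∫ x in {x : ℝ | τ < |x|}, x ^ 2 ∂μ + t ^ 3 * τ =
      ∫ x, (t ^ 2 * {x : ℝ | τ < |x|}.indicator (fun x => x ^ 2) x + t ^ 3 * τ * x ^ 2) ∂μ := by
    rw [integral_add (hi.const_mul _) (h.const_mul _), integral_const_mul, integral_const_mul, h2,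
      integral_indicator (measurableSet_lt_abs τ), mul_one]
  rw [e]
  refine integral_mono (integrable_min_sq_cube h t) ((hi.const_mul _).add (h.const_mul _))
    fun x => ?_
  by_cases hx : τ < |x|
  · simp only [Set.indicator_of_mem (show x ∈ {x : ℝ | τ < |x|} from hx), ← mul_pow]
    exact (min_le_left _ _).trans (le_add_of_nonneg_right (by positivity))
  · simp only [Set.indicator_of_notMem (show x ∉ {x : ℝ | τ < |x|} from hx), mul_zero, zero_add]
    refine (min_le_right _ _).trans ?_
    rw [abs_mul, abs_of_nonneg ht, mul_pow, pow_succ |x|, sq_abs, mul_comm (x ^ 2), ← mul_assoc]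
    gcongr
    exact not_lt.1 hx

theorem DisorderConditions.sum_integral_min_le (h : DisorderConditions p D) (hp : 1 ≤ p)
    {β ε : ℝ} (hβ : 0 < β) (hε : 0 < ε) {n : ℕ} (hn : 2 * p ≤ n) :
    ∑ e : Term n p, ∫ x, 126 / (β * n) *
        min ((β * Real.sqrt n / Real.sqrt (n.choose p) * x) ^ 2)
          (|β * Real.sqrt n / Real.sqrt (n.choose p) * x| ^ 3) ∂(D n e) ≤
      126 * β * averageTail D ε n +
        126 * β ^ 2 * 3 ^ p * Real.sqrt (2 ^ p * p.factorial) * ε := by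
  have hn0 : (0 : ℝ) < n := by exact_mod_cast (by omega : 0 < n)
  have hN : (0 : ℝ) < n.choose p := by exact_mod_cast Nat.choose_pos (by omega)
  set N : ℝ := ((n.choose p : ℕ) : ℝ) with hNdef
  set t := β * Real.sqrt n / Real.sqrt N with ht
  set τ := (n : ℝ) ^ (((p : ℝ) - 1) / 2) * ε with hτ
  have ht0 : 0 ≤ t := by positivity
  have hτ0 : 0 ≤ τ := by positivity
  have ht2 : t ^ 2 = β ^ 2 * n / N := by
    rw [ht, div_pow, mul_pow, Real.sq_sqrt hn0.le, Real.sq_sqrt hN.le]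
  -- Here the exponent `(p-1)/2` is decisive: `√n · n^((p-1)/2) = √(n^p)` is of the order of
  -- `√C(n,p)`.
  have htτ : t * τ ≤ β * Real.sqrt (2 ^ p * p.factorial) * ε := by
    have h1 : Real.sqrt n * (n : ℝ) ^ (((p : ℝ) - 1) / 2) = Real.sqrt ((n : ℝ) ^ p) := by
      rw [Real.sqrt_eq_rpow, Real.sqrt_eq_rpow, ← Real.rpow_natCast (n : ℝ) p, ← Real.rpow_mul hn0.le,
        ← Real.rpow_add hn0]
      congr 1
      ring
    have h2 : t * τ = β * (Real.sqrt ((n : ℝ) ^ p) / Real.sqrt N) * ε := by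
      rw [← h1, ht, hτ]
      ring
    rw [h2]
    gcongr
    rw [div_le_iff₀ (by positivity), ← Real.sqrt_mul (by positivity)]
    exact Real.sqrt_le_sqrt (pow_le_mul_choose hn)
  have hc : 0 ≤ 126 / (β * n) := by positivity
  calc ∑ e : Term n p, ∫ x, 126 / (β * n) * min ((t * x) ^ 2) (|t * x| ^ 3) ∂(D n e)
      ≤ ∑ e : Term n p, 126 / (β * n) *
          (t ^ 2 * ∫ x in {x : ℝ | τ < |x|}, x ^ 2 ∂(D n e) + t ^ 3 * τ) := by
        refine Finset.sum_le_sum fun e _ => ?_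
        rw [integral_const_mul]
        exact mul_le_mul_of_nonneg_left (integral_min_sq_cube_le (h.integrable_sq n e)
          (h.second_moment n e) ht0 hτ0) hc
    _ = 126 / (β * n) * (t ^ 2 * (N * averageTail D ε n) + N * 3 ^ p * (t ^ 2 * (t * τ))) := by
        rw [← Finset.mul_sum, Finset.sum_add_distrib, ← Finset.mul_sum, Finset.sum_const,
          Finset.card_univ, card_term, nsmul_eq_mul, averageTail, ← hNdef, ← mul_assoc N,
          mul_one_div_cancel hN.ne', one_mul, Fintype.sum_prod_type, ← hτ]
        push_cast
        ring
    _ = 126 * β * averageTail D ε n + 126 * β * 3 ^ p * (t * τ) := by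
        rw [ht2]
        field_simp
    _ ≤ 126 * β * averageTail D ε n +
          126 * β * 3 ^ p * (β * Real.sqrt (2 ^ p * p.factorial) * ε) := by gcongr
    _ = _ := by ring

theorem DisorderConditions.abs_integral_sub_le (h : DisorderConditions p D)
    (h' : DisorderConditions p D') (hp : 1 ≤ p) {β ε : ℝ} (hβ : 0 < β) (hε : 0 < ε) {n : ℕ}
    (hn : 2 * p ≤ n) :
    |∫ α, normalizedMaxEnergy n p α ∂(disorder (D n)) -
      ∫ α, normalizedMaxEnergy n p α ∂(disorder (D' n))| ≤
    2 * (Real.log 2 / β) + (126 * β * averageTail D ε n + 126 * β * averageTail D' ε n +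
        2 * (126 * β ^ 2 * 3 ^ p * Real.sqrt (2 ^ p * p.factorial) * ε)) := by
  have hn0 : 0 < n := by omega
  have hP := h.isProbability n
  have hP' := h'.isProbability n
  have hfb : ∀ α : Term n p → ℝ, |freeEnergy β n p α| ≤ Real.log 2 / β +
      1 / Real.sqrt n * (1 / Real.sqrt (n.choose p)) * ∑ e, |α e| := fun α => by
    have h1 := abs_freeEnergy_sub_normalizedMaxEnergy_le hβ hn0 α
    have h2 := abs_normalizedMaxEnergy_le α
    have h3 := abs_sub_abs_le_abs_sub (freeEnergy β n p α) (normalizedMaxEnergy n p α)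
    linarith
  have hclose : ∀ {E : ∀ n : ℕ, Term n p → Measure ℝ}, DisorderConditions p E →
      |∫ α, freeEnergy β n p α ∂(disorder (E n)) -
        ∫ α, normalizedMaxEnergy n p α ∂(disorder (E n))| ≤ Real.log 2 / β := fun {E} hE => by
    have := hE.isProbability n
    have hpr : IsProbabilityMeasure (disorder (E n)) := by
      unfold disorder
      infer_instance
    have hi : Integrable (freeEnergy β n p) (disorder (E n)) :=
      integrable_pi_of_abs_le (hE.integrable_sq n) (continuous_freeEnergy β) hfb
    rw [← integral_sub hi (hE.integrable_normalizedMaxEnergy n)]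
    simpa using norm_integral_le_of_norm_le_const (μ := disorder (E n))
      (f := fun α => freeEnergy β n p α - normalizedMaxEnergy n p α)
      (Eventually.of_forall fun α => abs_freeEnergy_sub_normalizedMaxEnergy_le hβ hn0 α)
  have key := abs_integral_pi_sub_le (h.first_moment n) (h.second_moment n) (h'.first_moment n)
    (h'.second_moment n) (continuous_freeEnergy β) hfb
    (fun e => (integrable_min_sq_cube (h.integrable_sq n e) _).const_mul _)
    (fun e => (integrable_min_sq_cube (h'.integrable_sq n e) _).const_mul _)
    (exists_abs_freeEnergy_taylor_le hβ)
  rw [Finset.sum_add_distrib] at key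
  have s := h.sum_integral_min_le hp hβ hε hn
  have s' := h'.sum_integral_min_le hp hβ hε hn
  have c := hclose h
  have c' := hclose h'
  simp only [disorder] at c c' ⊢
  rw [abs_le] at *
  constructor <;> linarith [key.1, key.2, c.1, c.2, c'.1, c'.2]

theorem DisorderConditions.tendsto_sub (h : DisorderConditions p D) (h' : DisorderConditions p D')
    (hp : 1 ≤ p) :
    Tendsto (fun n : ℕ => (∫ α, normalizedMaxEnergy n p α ∂(disorder (D n))) -
      ∫ α, normalizedMaxEnergy n p α ∂(disorder (D' n))) atTop (𝓝 0) := by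
  rw [Metric.tendsto_nhds]
  intro δ hδ
  -- `β` is fixed before `ε`, since `K` grows with `β`. The total error is below `(2 + 1 + 1 + 2)
  -- δ/8 < δ`.
  set β : ℝ := 8 / δ with hβdef
  have hβ : 0 < β := by positivity
  set K : ℝ := 126 * β ^ 2 * 3 ^ p * Real.sqrt (2 ^ p * p.factorial) with hK
  have hK0 : 0 ≤ K := by positivity
  set ε : ℝ := δ / (8 * (K + 1)) with hεdef
  have hε : 0 < ε := by positivity
  have t := ((h.boundedness ε hε).const_mul (126 * β)).eventually_lt_const
    (show 126 * β * 0 < δ / 8 by rw [mul_zero]; positivity)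
  have t' := ((h'.boundedness ε hε).const_mul (126 * β)).eventually_lt_const
    (show 126 * β * 0 < δ / 8 by rw [mul_zero]; positivity)
  filter_upwards [t, t', eventually_ge_atTop (2 * p)] with n ht ht' hn
  rw [dist_zero_right, Real.norm_eq_abs]
  refine (h.abs_integral_sub_le h' hp hβ hε hn).trans_lt ?_
  have e1 : Real.log 2 / β ≤ δ / 8 := by
    rw [hβdef, div_div_eq_mul_div]
    have := Real.log_two_lt_d9
    gcongr
    nlinarith
  have e2 : K * ε ≤ δ / 8 := by
    rw [hεdef, mul_div_assoc', div_le_div_iff₀ (by positivity) (by positivity)]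
    nlinarith
  change 126 * β * averageTail D ε n < δ / 8 at ht
  change 126 * β * averageTail D' ε n < δ / 8 at ht'
  linarith

/-- For `p = 1` the threshold is the constant `ε`. With `ε = 1/2`, values below it carry at most
`1/4` of the unit second moment, so the tails cannot vanish. -/
theorem not_disorderConditions_one (D : ∀ n : ℕ, Term n 1 → Measure ℝ) :
    ¬ DisorderConditions 1 D := by
  intro h
  have ht := (h.boundedness (1 / 2) (by norm_num)).eventually_lt_const
    (show (0 : ℝ) < 3 / 4 by norm_num)
  obtain ⟨n, hn, hlt⟩ := ((eventually_gt_atTop 0).and ht).exists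
  have hn0 : (0 : ℝ) < n := by exact_mod_cast hn
  refine hlt.not_ge ?_
  have hb : ∀ e : Term n 1, 3 / 4 ≤
      ∫ x in {x : ℝ | (n : ℝ) ^ ((((1 : ℕ) : ℝ) - 1) / 2) * (1 / 2) < |x|}, x ^ 2 ∂(D n e) := fun e => by
    have := h.isProbability n e
    have hm := measurableSet_lt_abs ((n : ℝ) ^ ((((1 : ℕ) : ℝ) - 1) / 2) * (1 / 2))
    have e1 := integral_add_compl hm (h.integrable_sq n e)
    rw [h.second_moment] at e1
    have e2 : ∫ x in {x : ℝ | (n : ℝ) ^ ((((1 : ℕ) : ℝ) - 1) / 2) * (1 / 2) < |x|}ᶜ, x ^ 2 ∂(D n e) ≤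
        ∫ x in {x : ℝ | (n : ℝ) ^ ((((1 : ℕ) : ℝ) - 1) / 2) * (1 / 2) < |x|}ᶜ, 1 / 4 ∂(D n e) := by
      refine setIntegral_mono_on (h.integrable_sq n e).integrableOn
        (integrable_const _).integrableOn hm.compl fun x hx => ?_
      have hx' : |x| ≤ 1 / 2 := by simpa using hx
      rw [← sq_abs]
      nlinarith [abs_nonneg x]
    have e3 := measureReal_le_one (μ := D n e)
      (s := {x : ℝ | (n : ℝ) ^ ((((1 : ℕ) : ℝ) - 1) / 2) * (1 / 2) < |x|}ᶜ)
    rw [setIntegral_const, smul_eq_mul] at e2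
    linarith
  have hs : ∑ _i : IncTuple n 1, ∑ _a : Fin 1 → Fin 3, (3 / 4 : ℝ) = n * 3 * (3 / 4) := by
    simp [card_incTuple]
    ring
  have hs' : (n : ℝ) * 3 * (3 / 4) ≤ _ := hs.symm.trans_le
    (Finset.sum_le_sum fun i _ => Finset.sum_le_sum fun a _ => hb (i, a))
  rw [Nat.choose_one_right]
  refine le_trans ?_ (mul_le_mul_of_nonneg_left hs' (by positivity))
  field_simp
  norm_num

end Comparison

/-! ### Identically distributed and Gaussian coefficients -/

section IdenticallyDistributed

variable {p : ℕ}

/-- Nothing is asked for `n < p`, where there are no terms; the average is `3^p` times a single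
tail. -/
theorem disorderConditions_of_identDistrib {ν : ℕ → Measure ℝ}
    (h0 : ∀ n, p ≤ n → IsProbabilityMeasure (ν n)) (h1 : ∀ n, p ≤ n → ∫ x, x ∂(ν n) = 0)
    (h2 : ∀ n, p ≤ n → ∫ x, x ^ 2 ∂(ν n) = 1)
    (h3 : ∀ ε : ℝ, 0 < ε → Tendsto (fun n : ℕ =>
      ∫ x in {x : ℝ | (n : ℝ) ^ (((p : ℝ) - 1) / 2) * ε < |x|}, x ^ 2 ∂(ν n)) atTop (𝓝 0)) :
    DisorderConditions p (fun n _ => ν n) := by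
  have hle : ∀ {n}, Term n p → p ≤ n := fun {n} e => by
    by_contra hn
    exact (isEmpty_term (not_le.1 hn)).false e
  refine ⟨fun n e => h0 n (hle e), fun n e => h1 n (hle e), fun n e => h2 n (hle e),
    fun ε hε => ?_⟩
  have := (h3 ε hε).const_mul (3 ^ p)
  rw [mul_zero] at this
  refine this.congr' ?_
  filter_upwards [eventually_ge_atTop p] with n hn
  have hN : (n.choose p : ℝ) ≠ 0 := by exact_mod_cast (Nat.choose_pos hn).ne'
  simp only [Finset.sum_const, Finset.card_univ, card_incTuple, Fintype.card_fun, Fintype.card_fin,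
    nsmul_eq_mul]
  push_cast
  field_simp

theorem tendsto_threshold_atTop (hp : 2 ≤ p) {ε : ℝ} (hε : 0 < ε) :
    Tendsto (fun n : ℕ => (n : ℝ) ^ (((p : ℝ) - 1) / 2) * ε) atTop atTop := by
  have : (2 : ℝ) ≤ p := by exact_mod_cast hp
  exact ((tendsto_rpow_atTop (by linarith)).comp tendsto_natCast_atTop_atTop).atTop_mul_const hε

/-- The threshold diverges when `p ≥ 2`, and above a threshold `τ` one has `x² ≤ x⁴/τ²`, with finite
fourth moment. -/
theorem disorderConditions_gaussian (hp : 2 ≤ p) :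
    DisorderConditions p (fun _ _ => gaussianReal 0 1) := by
  have hsq : Integrable (fun x : ℝ => x ^ 2) (gaussianReal 0 1) :=
    (memLp_two_iff_integrable_sq measurable_id.aestronglyMeasurable).1
      (memLp_id_gaussianReal' 2 (by simp))
  refine disorderConditions_of_identDistrib (fun _ _ => inferInstance)
    (fun _ _ => integral_id_gaussianReal) (fun _ _ => ?_) fun ε hε => ?_
  · have := variance_fun_id_gaussianReal (μ := 0) (v := 1)
    rw [variance_eq_integral measurable_id'.aemeasurable] at this
    simpa [integral_id_gaussianReal] using this
  · have h4 : Integrable (fun x : ℝ => x ^ 4) (gaussianReal 0 1) := by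
      have := (memLp_id_gaussianReal (μ := 0) (v := 1) 4).integrable_norm_pow (by norm_num)
      refine this.congr (Eventually.of_forall fun x => ?_)
      simp [Real.norm_eq_abs, Even.pow_abs (by decide : Even 4)]
    have hl := ((tendsto_threshold_atTop hp hε).comp tendsto_id).inv_tendsto_atTop.pow 2
    have hl' := hl.mul_const (∫ x, x ^ 4 ∂(gaussianReal 0 1))
    rw [zero_pow two_ne_zero, zero_mul] at hl'
    refine squeeze_zero' (Eventually.of_forall fun n => integral_nonneg fun x => sq_nonneg x) ?_ hl'
    filter_upwards [(tendsto_threshold_atTop hp hε).eventually_gt_atTop 0] with n hn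
    simp only [Pi.inv_apply, Function.comp_apply, id]
    rw [← integral_indicator (measurableSet_lt_abs _), ← integral_const_mul]
    refine integral_mono (hsq.indicator (measurableSet_lt_abs _)) (h4.const_mul _) fun x => ?_
    refine Set.indicator_apply_le' (fun hx => ?_) (fun _ => by positivity)
    have hx' : ((n : ℝ) ^ (((p : ℝ) - 1) / 2) * ε) ^ 2 ≤ x ^ 2 := by
      rw [← sq_abs x]
      exact pow_le_pow_left₀ hn.le (le_of_lt hx) 2
    rw [inv_pow, ← div_eq_inv_mul, le_div_iff₀ (by positivity)]
    nlinarith [sq_nonneg x]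

theorem DisorderConditions.sameLimitingEnergy {D : ∀ n : ℕ, Term n p → Measure ℝ}
    (h : DisorderConditions p D) (hp : 1 ≤ p) : SameLimitingEnergy p D := by
  rcases hp.eq_or_lt with rfl | hp2
  · exact (not_disorderConditions_one D h).elim
  have hG := disorderConditions_gaussian hp2
  have ht := hG.tendsto_sub h hp
  refine ⟨hG.integrable_normalizedMaxEnergy, h.integrable_normalizedMaxEnergy, ht, fun L => ?_⟩
  constructor <;> intro hL
  · simpa [gaussianDisorder] using hL.sub ht
  · simpa [gaussianDisorder] using hL.add ht

end IdenticallyDistributed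

/-! ### The sparse model -/

section Sparse

variable {n p : ℕ} {d : ℝ}

theorem sparseProb_mem (hd : 0 < d) (hd' : d ≤ 3 ^ p * (n.choose (p - 1) : ℝ)) :
    0 < sparseProb n p d ∧ sparseProb n p d ≤ 1 :=
  ⟨div_pos hd (hd.trans_le hd'), div_le_one_of_le₀ hd' (hd.trans_le hd').le⟩

theorem integral_sparseLaw (hd : 0 < d) (hd' : d ≤ 3 ^ p * (n.choose (p - 1) : ℝ)) (f : ℝ → ℝ) :
    ∫ x, f x ∂(sparseLaw n p d) = (1 - sparseProb n p d) * f 0 +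
      sparseProb n p d / 2 * f (Real.sqrt (3 ^ p * (n.choose (p - 1) : ℝ) / d)) +
      sparseProb n p d / 2 * f (-Real.sqrt (3 ^ p * (n.choose (p - 1) : ℝ) / d)) := by
  obtain ⟨h0, h1⟩ := sparseProb_mem hd hd'
  have hi : ∀ (c a : ℝ), Integrable f (ENNReal.ofReal c • Measure.dirac a) := fun c a =>
    (integrable_dirac (by simp)).smul_measure ENNReal.ofReal_ne_top
  rw [sparseLaw, integral_add_measure ((hi _ _).add_measure (hi _ _)) (hi _ _),
    integral_add_measure (hi _ _) (hi _ _)]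
  simp only [integral_smul_measure, integral_dirac, smul_eq_mul]
  rw [ENNReal.toReal_ofReal (by linarith), ENNReal.toReal_ofReal (by linarith)]

theorem isProbabilityMeasure_sparseLaw (hd : 0 < d) (hd' : d ≤ 3 ^ p * (n.choose (p - 1) : ℝ)) :
    IsProbabilityMeasure (sparseLaw n p d) := by
  obtain ⟨h0, h1⟩ := sparseProb_mem hd hd'
  refine ⟨?_⟩
  simp only [sparseLaw, Measure.add_apply, Measure.smul_apply, measure_univ, smul_eq_mul, mul_one]
  rw [← ENNReal.ofReal_add (by linarith) (by linarith), ← ENNReal.ofReal_add (by linarith)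
    (by linarith), ← ENNReal.ofReal_one]
  congr 1
  ring

/-- As `C(n,p-1) ≤ n^(p-1)`, the nonzero values lie within the threshold once `d n ≥ 3^p/ε²`, so the
tails are eventually exactly zero, however slowly `d` diverges. -/
theorem disorderConditions_sparse {d : ℕ → ℝ} (hd : Tendsto d atTop atTop)
    (hb : ∀ n : ℕ, p ≤ n → 0 < d n ∧ d n ≤ 3 ^ p * (n.choose (p - 1) : ℝ)) (hp : 1 ≤ p) :
    DisorderConditions p (fun n _ => sparseLaw n p (d n)) := by
  refine disorderConditions_of_identDistrib
    (fun n hn => isProbabilityMeasure_sparseLaw (hb n hn).1 (hb n hn).2) (fun n hn => ?_)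
    (fun n hn => ?_) fun ε hε => ?_
  · rw [integral_sparseLaw (hb n hn).1 (hb n hn).2]
    ring
  · obtain ⟨h0, h1⟩ := hb n hn
    have hC := h0.trans_le h1
    rw [integral_sparseLaw h0 h1, neg_sq, Real.sq_sqrt (by positivity), sparseProb]
    have : (n.choose (p - 1) : ℝ) ≠ 0 := fun h => by simp [h] at hC
    field_simp
    ring
  · refine tendsto_const_nhds.congr' ?_
    filter_upwards [eventually_ge_atTop p, hd.eventually_ge_atTop (3 ^ p / ε ^ 2)] with n hn hdn
    obtain ⟨h0, h1⟩ := hb n hn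
    have hτ : Real.sqrt (3 ^ p * (n.choose (p - 1) : ℝ) / d n) ≤
        (n : ℝ) ^ (((p : ℝ) - 1) / 2) * ε := by
      refine Real.sqrt_le_iff.2 ⟨by positivity, ?_⟩
      have e1 : ((n : ℝ) ^ (((p : ℝ) - 1) / 2)) ^ 2 = (n : ℝ) ^ (p - 1) := by
        rw [← Real.rpow_natCast, ← Real.rpow_mul (by positivity), ← Real.rpow_natCast,
          Nat.cast_sub hp]
        congr 1
        push_cast
        ring
      rw [mul_pow, e1, div_le_iff₀ h0]
      rw [div_le_iff₀ (by positivity)] at hdn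
      have e2 : (n.choose (p - 1) : ℝ) ≤ (n : ℝ) ^ (p - 1) := by
        exact_mod_cast Nat.choose_le_pow n (p - 1)
      calc (3 : ℝ) ^ p * n.choose (p - 1) ≤ (d n * ε ^ 2) * (n : ℝ) ^ (p - 1) := by gcongr
        _ = _ := by ring
    symm
    rw [← integral_indicator (measurableSet_lt_abs _), integral_sparseLaw h0 h1]
    have hs := Real.sqrt_nonneg (3 ^ p * (n.choose (p - 1) : ℝ) / d n)
    simp only [Set.indicator_apply, Set.mem_ofPred_eq, abs_neg, abs_of_nonneg hs, not_lt.2 hτ]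
    simp

end Sparse

end QuantumSpin

theorem mainTheorem4 (p : ℕ) (hp : 1 ≤ p) :
    (∀ D : (n : ℕ) → QuantumSpin.Term n p → Measure ℝ,
      QuantumSpin.DisorderConditions p D → QuantumSpin.SameLimitingEnergy p D) ∧
    (∀ d : ℕ → ℝ, Tendsto d atTop atTop →
      (∀ n : ℕ, p ≤ n → 0 < d n ∧ d n ≤ 3 ^ p * (n.choose (p - 1) : ℝ)) →
      QuantumSpin.DisorderConditions p (fun n _ => QuantumSpin.sparseLaw n p (d n)) ∧
      QuantumSpin.SameLimitingEnergy p (fun n _ => QuantumSpin.sparseLaw n p (d n))) := by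
  refine ⟨fun D hD => hD.sameLimitingEnergy hp, fun d hd hb => ?_⟩
  have h := QuantumSpin.disorderConditions_sparse hd hb hp
  exact ⟨h, h.sameLimitingEnergy hp⟩
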